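/- Let $\alpha,\beta>-1$ and let $J^{\alpha,\beta}(dx)=(1-x)^{\alpha}(1+x)^{\beta}\,dx$ be the Jacobi measure on $[-1,1]$. Let $(P_n^{\alpha,\beta})_{n\ge 0}$ be the Jacobi polynomials, i.e. the polynomials with $\deg P_n^{\alpha,\beta}=n$ that are orthogonal with respect to $J^{\alpha,\beta}$ and normalized by $P_n^{\alpha,\beta}(1)=\binom{n+\alpha}{n}$; explicitly, $$P_n^{\alpha,\beta}(x)=\sum_{s=0}^{n}\binom{n+\alpha}{n-s}\binom{n+\beta}{s}\Big(\frac{x-1}{2}\Big)^{s}\Big(\frac{x+1}{2}\Big)^{n-s}.$$ Put $h_n=\int_{-1}^{1}P_n^{\alpha,\beta}(x)^2\,J^{\alpha,\beta}(dx)$. Let $1\le p<\infty$ and let $f\in L^p([-1,1],J^{\alpha,\beta})$ be real or complex valued, with norm $\|f\|_{p,\alpha,\beta}=\big(\int_{-1}^{1}|f|^p\,dJ^{\alpha,\beta}\big)^{1/p}$. Define $$\hat f(n)=\frac1{h_n}\int_{-1}^{1}f(y)\,P_n^{\alpha,\beta}(y)\,J^{\alpha,\beta}(dy),\qquad f^{\alpha,\beta}(r,x)=\sum_{n=0}^{\infty}r^n\hat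 f(n)P_n^{\alpha,\beta}(x)\quad(0<r<1).$$ Then for every $0<r<1$ the series $f^{\alpha,\beta}(r,x)$ converges absolutely at every $x\in[-1,1]$ and $f^{\alpha,\beta}(r,\cdot)\in L^p([-1,1],J^{\alpha,\beta})$, and $$\|f^{\alpha,\beta}(r,\cdot)-f\|_{p,\alpha,\beta}\longrightarrow 0\qquad\text{as } r\to1^-.$$ -/

import Mathlib

open MeasureTheory Filter Topology Polynomial
open scoped ENNReal

noncomputable section

/-- The Jacobi measure `(1 - x)^α (1 + x)^β dx` on `[-1, 1]`, as a measure on `ℝ`. -/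
def jacobiMeasure (α β : ℝ) : Measure ℝ :=
  (volume.restrict (Set.Icc (-1 : ℝ) 1)).withDensity
    (fun x => ENNReal.ofReal ((1 - x) ^ α * (1 + x) ^ β))

/-- The Jacobi polynomial `P_n^{α,β}`, normalized by `P_n^{α,β}(1) = binom(n + α, n)`:
`∑_{s=0}^n binom(n+α, n-s) binom(n+β, s) ((x-1)/2)^s ((x+1)/2)^(n-s)`.
Here `Ring.choose a k = a (a-1) ⋯ (a-k+1) / k!` for real `a`. -/
def jacobiPoly (α β : ℝ) (n : ℕ) : ℝ[X] :=
  ∑ s ∈ Finset.range (n + 1),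
    C (Ring.choose ((n : ℝ) + α) (n - s) * Ring.choose ((n : ℝ) + β) s) *
      (C (1 / 2) * (X - 1)) ^ s * (C (1 / 2) * (X + 1)) ^ (n - s)

/-- The normalization of the Jacobi polynomials at `1`. -/
theorem jacobiPoly_eval_one (α β : ℝ) (n : ℕ) :
    (jacobiPoly α β n).eval 1 = Ring.choose ((n : ℝ) + α) n := by
  unfold jacobiPoly
  rw [eval_finsetSum, Finset.sum_eq_single 0]
  · simp; norm_num
  · intro s _ hs
    simp [hs]
  · simp

/-- `h_n^{α,β} = ∫ (P_n^{α,β})² dJ^{α,β}`. -/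
def jacobiNormSq (α β : ℝ) (n : ℕ) : ℝ :=
  ∫ x, ((jacobiPoly α β n).eval x) ^ 2 ∂(jacobiMeasure α β)

/-- The `n`-th Fourier-Jacobi coefficient
`(1 / h_n) ∫ f(y) P_n(y) J^{α,β}(dy)` of a real or complex valued function `f`. -/
def jacobiCoeff {𝕜 : Type*} [RCLike 𝕜] (α β : ℝ) (f : ℝ → 𝕜) (n : ℕ) : 𝕜 :=
  (1 / jacobiNormSq α β n) •
    ∫ y, (jacobiPoly α β n).eval y • f y ∂(jacobiMeasure α β)

/-- The `n`-th term `r^n f̂(n) P_n(x)` of the Abel means of the Fourier-Jacobi series of `f`. -/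
def jacobiAbelTerm {𝕜 : Type*} [RCLike 𝕜] (α β : ℝ) (f : ℝ → 𝕜) (r x : ℝ) (n : ℕ) : 𝕜 :=
  (r ^ n * (jacobiPoly α β n).eval x) • jacobiCoeff α β f n

/-- The Abel means `f^{α,β}(r, x) = ∑_n r^n f̂(n) P_n(x)`. -/
def jacobiAbel {𝕜 : Type*} [RCLike 𝕜] (α β : ℝ) (f : ℝ → 𝕜) (r x : ℝ) : 𝕜 :=
  ∑' n, jacobiAbelTerm α β f r x n

end

/-! The Abel means are integrals against the kernel K_r(x,y) = ∑ r^n P_n(x) P_n(y) / h_n. Once K_r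
is known to be nonnegative, symmetric and of total mass one, Jensen and Tonelli make each Abel mean
a contraction of L^p. On finite combinations of Jacobi polynomials the means converge because r^n →
1 in finitely many terms; such combinations are dense, and an ε/3 argument concludes.

Positivity comes from a maximum principle rather than from a closed formula for K_r. The P_n are
eigenfunctions of L = `jacobiOp` with eigenvalues n(n+α+β+1) (`jacobiOp_jacobiPoly`), so u(r,x) = ∑
a_n r^n P_n(x) satisfies r² u_rr + (α+β+2) r u_r = L u. At a minimum in x one has L u ≤ 0, even at x
= ±1, where L degenerates to first order (`eval_jacobiOp_nonpos_of_isMinOn`). Hence u ≥ 0 as soon as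
u(1,·) ≥ 0 (`poissonExtension_nonneg`). So K_r integrates nonnegative polynomials to nonnegative
numbers, and Weierstrass approximation of its negative part yields K_r ≥ 0
(`ae_jacobiKernel_nonneg`).

Convergence of the kernel needs only that P_n(x) P_n(y) / h_n grows polynomially in n
(`exists_jacobiPoly_growth`): the differential equation bounds P_n' by a multiple of the eigenvalue
times max |P_n|, so P_n stays large on an interval near its maximum, which bounds h_n from below. -/

/-! ### Differential equation, degrees and spanning -/

/-- The Jacobi differential operator
`p ↦ (x² - 1) p'' + ((α + β + 2) x + (α - β)) p'`. -/
noncomputable def jacobiOp (α β : ℝ) : ℝ[X] →ₗ[ℝ] ℝ[X] :=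
  LinearMap.mulLeft ℝ (X ^ 2 - 1) ∘ₗ derivative ∘ₗ derivative +
    LinearMap.mulLeft ℝ (C (α + β + 2) * X + C (α - β)) ∘ₗ derivative

theorem jacobiOp_apply (α β : ℝ) (p : ℝ[X]) :
    jacobiOp α β p = (X ^ 2 - 1) * derivative (derivative p) +
      (C (α + β + 2) * X + C (α - β)) * derivative p := rfl

/-- The eigenvalue of the Jacobi operator at the `n`-th Jacobi polynomial. -/
def jacobiEigenvalue (α β : ℝ) (n : ℕ) : ℝ := n * (n + α + β + 1)

theorem ringChoose_succ_mul (a : ℝ) (k : ℕ) :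
    Ring.choose a (k + 1) * (k + 1) = Ring.choose a k * (a - k) := by
  have h := Ring.choose_smul_choose a (Nat.le_succ k)
  simpa [Nat.choose_succ_self_right, mul_comm] using h

theorem ringChoose_pos {a : ℝ} (k : ℕ) (h : (k : ℝ) - 1 < a) : 0 < Ring.choose a k := by
  induction k with
  | zero => simp
  | succ k ih =>
    push_cast at h
    have h1 := ringChoose_succ_mul a k
    have h2 := ih (by linarith)
    have h3 : 0 < Ring.choose a k * (a - k) := mul_pos h2 (by linarith)
    rw [← h1] at h3
    exact pos_of_mul_pos_left h3 (by positivity)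

/-- The coefficients of the homogeneous form of the Jacobi polynomial. -/
noncomputable def jacobiPolyCoeff (α β : ℝ) (n s : ℕ) : ℝ :=
  Ring.choose ((n : ℝ) + α) (n - s) * Ring.choose ((n : ℝ) + β) s

/-- This recurrence turns the terms that `jacobiOp` shifts to neighbouring monomials back into
diagonal ones. -/
theorem jacobiPolyCoeff_succ (α β : ℝ) {n s : ℕ} (hs : s < n) :
    (s + 1) * (s + 1 + α) * jacobiPolyCoeff α β n (s + 1) =
      (n - s) * (n - s + β) * jacobiPolyCoeff α β n s := by
  obtain ⟨k, rfl⟩ := Nat.exists_eq_add_of_lt hs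
  have e1 : s + k + 1 - (s + 1) = k := by omega
  have e2 : s + k + 1 - s = k + 1 := by omega
  have h1 := ringChoose_succ_mul (((s + k + 1 : ℕ) : ℝ) + α) k
  have h2 := ringChoose_succ_mul (((s + k + 1 : ℕ) : ℝ) + β) s
  simp only [jacobiPolyCoeff, e1, e2]
  push_cast at h1 h2 ⊢
  linear_combination (-((k : ℝ) + 1 + β)) * Ring.choose ((s : ℝ) + k + 1 + β) s * h1 +
    (s + 1 + α) * Ring.choose ((s : ℝ) + k + 1 + α) k * h2

/-- With u = (x-1)/2 and v = (x+1)/2 one has x² - 1 = 4uv, and the first-order coefficient is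
2(α+1)v + 2(β+1)u. The operator is thus homogeneous in u, v. Truncated exponents are harmless: their
coefficients s or k vanish. -/
theorem jacobiOp_pow_mul_pow (α β : ℝ) (s k : ℕ) :
    jacobiOp α β ((C (1 / 2) * (X - 1)) ^ s * (C (1 / 2) * (X + 1)) ^ k) =
      C (s * (s + α)) * ((C (1 / 2) * (X - 1)) ^ (s - 1) * (C (1 / 2) * (X + 1)) ^ (k + 1)) +
      C (k * (k + β)) * ((C (1 / 2) * (X - 1)) ^ (s + 1) * (C (1 / 2) * (X + 1)) ^ (k - 1)) +
      C (2 * s * k + (α + 1) * k + (β + 1) * s) *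
        ((C (1 / 2) * (X - 1)) ^ s * (C (1 / 2) * (X + 1)) ^ k) := by
  obtain ⟨u, hu⟩ : ∃ u : ℝ[X], u = C (1 / 2) * (X - 1) := ⟨_, rfl⟩
  obtain ⟨v, hv⟩ : ∃ v : ℝ[X], v = C (1 / 2) * (X + 1) := ⟨_, rfl⟩
  have h2 : (C (1 / 2) : ℝ[X]) * 2 = 1 := by
    rw [show (2 : ℝ[X]) = C 2 from rfl, ← C_mul]; norm_num
  have hdu : derivative u = C (1 / 2) := by simp [hu]
  have hdv : derivative v = C (1 / 2) := by simp [hv]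
  have e1 : (X ^ 2 - 1 : ℝ[X]) = 4 * u * v := by
    rw [hu, hv]; linear_combination (-(X ^ 2 - 1 : ℝ[X])) * (1 + C (1 / 2) * 2) * h2
  have e2 : (C (α + β + 2) * X + C (α - β) : ℝ[X]) =
      2 * C (α + 1) * v + 2 * C (β + 1) * u := by
    rw [hu, hv]; simp only [C_add, C_sub, C_1, show (C 2 : ℝ[X]) = 2 from rfl]
    linear_combination (-((C α + 1) * (X + 1) + (C β + 1) * (X - 1)) : ℝ[X]) * h2
  rw [jacobiOp_apply, ← hu, ← hv, e1, e2]
  simp only [C_add, C_mul, C_1, show (C 2 : ℝ[X]) = 2 from rfl, map_natCast]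
  obtain ⟨c, hc⟩ : ∃ c : ℝ[X], c = C (1 / 2) := ⟨_, rfl⟩
  rw [← hc] at hdu hdv h2
  have h4 : 4 * c * c = 1 := by linear_combination (2 * c + 1) * h2
  have hD (i j : ℕ) : derivative (u ^ i * v ^ j) =
      c * (i * (u ^ (i - 1) * v ^ j) + j * (u ^ i * v ^ (j - 1))) := by
    rw [derivative_mul, derivative_pow, derivative_pow, hdu, hdv]
    simp only [map_natCast]
    ring
  have hD2 : derivative (derivative (u ^ s * v ^ k)) =
      c * c * (s * (((s - 1 : ℕ) : ℝ[X]) * (u ^ (s - 1 - 1) * v ^ k) +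
        k * (u ^ (s - 1) * v ^ (k - 1))) +
        k * (s * (u ^ (s - 1) * v ^ (k - 1)) +
          ((k - 1 : ℕ) : ℝ[X]) * (u ^ s * v ^ (k - 1 - 1)))) := by
    have hdc : derivative c = 0 := by rw [hc]; exact derivative_C
    rw [hD, derivative_mul, hdc, derivative_add, derivative_natCast_mul, derivative_natCast_mul,
      hD, hD]
    ring
  rw [hD2, hD]
  obtain ⟨D1, hD1⟩ : ∃ D, D = (s * (u ^ (s - 1) * v ^ k) + k * (u ^ s * v ^ (k - 1)) : ℝ[X]) :=
    ⟨_, rfl⟩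
  obtain ⟨D2, hD2⟩ : ∃ D, D = (s * (((s - 1 : ℕ) : ℝ[X]) * (u ^ (s - 1 - 1) * v ^ k) +
        k * (u ^ (s - 1) * v ^ (k - 1))) +
        k * (s * (u ^ (s - 1) * v ^ (k - 1)) +
          ((k - 1 : ℕ) : ℝ[X]) * (u ^ s * v ^ (k - 1 - 1))) : ℝ[X]) := ⟨_, rfl⟩
  rw [← hD1, ← hD2]
  suffices h : u * v * D2 + ((C α + 1) * v + (C β + 1) * u) * D1 =
      s * (s + C α) * (u ^ (s - 1) * v ^ (k + 1)) + k * (k + C β) * (u ^ (s + 1) * v ^ (k - 1)) +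
      (2 * s * k + (C α + 1) * k + (C β + 1) * s) * (u ^ s * v ^ k) by
    rw [← h]
    linear_combination u * v * D2 * h4 + ((C α + 1) * v + (C β + 1) * u) * D1 * h2
  rw [hD1, hD2]
  rcases s with _ | _ | s <;> rcases k with _ | _ | k <;>
    simp [-mul_eq_mul_right_iff] <;> ring

/-- The Jacobi differential equation. -/
theorem jacobiOp_jacobiPoly (α β : ℝ) (n : ℕ) :
    jacobiOp α β (jacobiPoly α β n) = jacobiEigenvalue α β n • jacobiPoly α β n := by
  obtain ⟨m, hm⟩ : ∃ m : ℕ → ℝ[X], ∀ s, m s =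
    (C (1 / 2) * (X - 1)) ^ s * (C (1 / 2) * (X + 1)) ^ (n - s) := ⟨_, fun _ => rfl⟩
  obtain ⟨c, hc⟩ : ∃ c : ℕ → ℝ, ∀ s, c s = jacobiPolyCoeff α β n s := ⟨_, fun _ => rfl⟩
  have hP : jacobiPoly α β n = ∑ s ∈ Finset.range (n + 1), C (c s) * m s := by
    simp only [jacobiPoly, hc, hm, jacobiPolyCoeff, mul_assoc]
  have hE : ∑ s ∈ Finset.range (n + 1), C (c s * (s * (s + α))) *
      ((C (1 / 2) * (X - 1)) ^ (s - 1) * (C (1 / 2) * (X + 1)) ^ (n - s + 1)) =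
      ∑ s ∈ Finset.range (n + 1), C (c s * ((n - s) * (n - s + β))) * m s := by
    rw [Finset.sum_range_succ', Finset.sum_range_succ]
    simp only [Nat.cast_zero, zero_mul, mul_zero, C_0, sub_self, add_zero]
    refine Finset.sum_congr rfl fun s hs => ?_
    have hs' := Finset.mem_range.1 hs
    have h := jacobiPolyCoeff_succ α β hs'
    rw [hm, hc, hc, show n - (s + 1) + 1 = n - s by omega, Nat.add_sub_cancel]
    congr 2
    push_cast
    linarith
  have hF : ∑ s ∈ Finset.range (n + 1),
      C (c s * (((n - s : ℕ) : ℝ) * (((n - s : ℕ) : ℝ) + β))) *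
      ((C (1 / 2) * (X - 1)) ^ (s + 1) * (C (1 / 2) * (X + 1)) ^ (n - s - 1)) =
      ∑ s ∈ Finset.range (n + 1), C (c s * (s * (s + α))) * m s := by
    rw [Finset.sum_range_succ, Finset.sum_range_succ']
    simp only [Nat.cast_zero, zero_mul, mul_zero, C_0, Nat.sub_self, add_zero]
    refine Finset.sum_congr rfl fun s hs => ?_
    have hs' := Finset.mem_range.1 hs
    have h := jacobiPolyCoeff_succ α β hs'
    rw [hm, hc, hc, show n - (s + 1) = n - s - 1 by omega]
    congr 2
    rw [Nat.cast_sub hs'.le]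
    push_cast
    linarith
  have hL (s : ℕ) : jacobiOp α β (C (c s) * m s) =
      C (c s * (s * (s + α))) *
        ((C (1 / 2) * (X - 1)) ^ (s - 1) * (C (1 / 2) * (X + 1)) ^ (n - s + 1)) +
      C (c s * (((n - s : ℕ) : ℝ) * (((n - s : ℕ) : ℝ) + β))) *
        ((C (1 / 2) * (X - 1)) ^ (s + 1) * (C (1 / 2) * (X + 1)) ^ (n - s - 1)) +
      C (c s * (2 * s * (n - s : ℕ) + (α + 1) * (n - s : ℕ) + (β + 1) * s)) * m s := by
    rw [← smul_eq_C_mul, map_smul, hm, jacobiOp_pow_mul_pow, smul_eq_C_mul]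
    simp only [C_mul]
    ring
  rw [hP, map_sum, Finset.smul_sum, Finset.sum_congr rfl fun s _ => hL s, Finset.sum_add_distrib,
    Finset.sum_add_distrib, hE, hF, ← Finset.sum_add_distrib, ← Finset.sum_add_distrib]
  refine Finset.sum_congr rfl fun s hs => ?_
  rw [smul_eq_C_mul, ← add_mul, ← add_mul, ← C_add, ← C_add, ← mul_assoc (C _) (C _), ← C_mul]
  congr 2
  rw [Nat.cast_sub (Finset.mem_range_succ_iff.1 hs), jacobiEigenvalue]
  ring

theorem jacobiPoly_ne_zero {α : ℝ} (hα : -1 < α) (β : ℝ) (n : ℕ) : jacobiPoly α β n ≠ 0 := by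
  intro h
  have h1 := jacobiPoly_eval_one α β n
  rw [h, eval_zero] at h1
  exact (ringChoose_pos n (by linarith)).ne h1

theorem jacobiEigenvalue_injective {α β : ℝ} (hα : -1 < α) (hβ : -1 < β) :
    Function.Injective (jacobiEigenvalue α β) := by
  intro m n h
  by_contra hmn
  simp only [jacobiEigenvalue] at h
  have h1 : ((m : ℝ) - n) * (m + n + α + β + 1) = 0 := by linear_combination h
  -- Distinct indices are not both zero, so m + n + α + β + 1 > 0 follows from α + β > -2.
  have h2 : (1 : ℝ) ≤ m + n := by exact_mod_cast (by omega : 1 ≤ m + n)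
  rcases mul_eq_zero.1 h1 with h3 | h3
  · exact hmn (by exact_mod_cast sub_eq_zero.1 h3)
  · linarith

theorem coeff_jacobiOp_natDegree (α β : ℝ) (p : ℝ[X]) :
    (jacobiOp α β p).coeff p.natDegree =
      jacobiEigenvalue α β p.natDegree * p.leadingCoeff := by
  have hc {k : ℕ} (hk : p.natDegree < k) : p.coeff k = 0 := coeff_eq_zero_of_natDegree_lt hk
  rw [jacobiOp_apply, jacobiEigenvalue, leadingCoeff]
  generalize p.natDegree = n at *
  rw [sub_mul, add_mul, one_mul, coeff_add, coeff_sub, coeff_add, mul_assoc, coeff_C_mul,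
    coeff_C_mul]
  rcases n with _ | _ | n
  · simp [coeff_derivative, hc]
  · simp [-mul_eq_mul_right_iff, coeff_derivative, hc, coeff_X_pow_mul', coeff_X_mul]
    ring
  · rw [coeff_X_pow_mul', if_pos (by omega), coeff_X_mul]
    simp [coeff_derivative, hc]
    ring

/-- The top coefficient of L p is the eigenvalue indexed by deg p times that of p; as the
eigenvalues are distinct, the eigenvalue of P_n reveals its degree. -/
theorem natDegree_jacobiPoly {α β : ℝ} (hα : -1 < α) (hβ : -1 < β) (n : ℕ) :
    (jacobiPoly α β n).natDegree = n := by
  have h := coeff_jacobiOp_natDegree α β (jacobiPoly α β n)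
  rw [jacobiOp_jacobiPoly, coeff_smul, smul_eq_mul] at h
  exact (jacobiEigenvalue_injective hα hβ (mul_right_cancel₀
    (leadingCoeff_ne_zero.2 (jacobiPoly_ne_zero hα β n)) h)).symm

/-- Every real polynomial is a finite combination of Jacobi polynomials. -/
theorem exists_sum_jacobiPoly {α β : ℝ} (hα : -1 < α) (hβ : -1 < β) (q : ℝ[X]) :
    ∃ (N : ℕ) (a : ℕ → ℝ), ∀ M ≥ N, q = ∑ n ∈ Finset.range M, a n • jacobiPoly α β n := by
  let S : Polynomial.Sequence ℝ := ⟨jacobiPoly α β, fun n => by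
    rw [degree_eq_natDegree (jacobiPoly_ne_zero hα β n), natDegree_jacobiPoly hα hβ]⟩
  let B := S.basis fun n => (leadingCoeff_ne_zero.2 (jacobiPoly_ne_zero hα β n)).isUnit
  obtain ⟨N, hN⟩ := (B.repr q).support.exists_nat_subset_range
  refine ⟨N, B.repr q, fun M hM => ?_⟩
  conv_lhs => rw [← B.linearCombination_repr q, Finsupp.linearCombination_apply]
  rw [Finsupp.sum_of_support_subset _ (hN.trans (Finset.range_mono hM)) _ (by simp)]
  refine Finset.sum_congr rfl fun n _ => ?_
  rw [show B n = jacobiPoly α β n by simp [B]; rfl]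

/-! ### The weight and the Jacobi measure -/

/-- The Jacobi weight `(1 - x)^α (1 + x)^β`. -/
noncomputable def jacobiWeight (α β x : ℝ) : ℝ := (1 - x) ^ α * (1 + x) ^ β

theorem measurable_jacobiWeight (α β : ℝ) : Measurable (jacobiWeight α β) :=
  ((measurable_const.sub measurable_id).pow_const α).mul
    ((measurable_const.add measurable_id).pow_const β)

theorem jacobiWeight_nonneg (α β : ℝ) {x : ℝ} (hx : x ∈ Set.Icc (-1 : ℝ) 1) :
    0 ≤ jacobiWeight α β x :=
  mul_nonneg (Real.rpow_nonneg (by linarith [hx.2]) _) (Real.rpow_nonneg (by linarith [hx.1]) _)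

theorem rpow_le_two_rpow_abs {t : ℝ} (h1 : 1 ≤ t) (h2 : t ≤ 2) (γ : ℝ) : t ^ γ ≤ 2 ^ |γ| :=
  (Real.rpow_le_rpow_of_exponent_le h1 (le_abs_self γ)).trans
    (Real.rpow_le_rpow (by linarith) h2 (abs_nonneg γ))

theorem intervalIntegrable_jacobiWeight {α β : ℝ} (hα : -1 < α) (hβ : -1 < β) :
    IntervalIntegrable (jacobiWeight α β) volume (-1) 1 := by
  have h1 : IntervalIntegrable (fun x : ℝ => (1 - x) ^ α) volume (-1) 1 := by
    have := (intervalIntegral.intervalIntegrable_rpow' (a := 2) (b := 0) hα).comp_sub_left 1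
    norm_num at this
    exact this
  have h2 : IntervalIntegrable (fun x : ℝ => (1 + x) ^ β) volume (-1) 1 := by
    have := (intervalIntegral.intervalIntegrable_rpow' (a := 0) (b := 2) hβ).comp_add_left 1
    norm_num at this
    exact this
  -- Each half of the interval carries only one singular factor; the other is at most 2 to the
  -- absolute value of its exponent.
  refine ((h1.const_mul (2 ^ |β|)).add (h2.const_mul (2 ^ |α|))).mono_fun
    (measurable_jacobiWeight α β).aestronglyMeasurable ?_
  rw [Set.uIoc_of_le (by norm_num)]
  filter_upwards [ae_restrict_mem measurableSet_Ioc] with x hx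
  have hx' := Set.Ioc_subset_Icc_self hx
  have e1 : 0 ≤ (1 - x) ^ α := Real.rpow_nonneg (by linarith [hx.2]) _
  have e2 : 0 ≤ (1 + x) ^ β := Real.rpow_nonneg (by linarith [hx.1]) _
  have e3 : (0 : ℝ) ≤ 2 ^ |β| := by positivity
  have e4 : (0 : ℝ) ≤ 2 ^ |α| := by positivity
  rw [Real.norm_of_nonneg (jacobiWeight_nonneg α β hx'), Real.norm_of_nonneg (by positivity),
    jacobiWeight]
  rcases le_total 0 x with h | h
  · have := mul_le_mul_of_nonneg_left
      (rpow_le_two_rpow_abs (t := 1 + x) (by linarith) (by linarith [hx.2]) β) e1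
    nlinarith [mul_nonneg e4 e2]
  · have := mul_le_mul_of_nonneg_right
      (rpow_le_two_rpow_abs (t := 1 - x) (by linarith) (by linarith [hx.1]) α) e2
    nlinarith [mul_nonneg e3 e1]

theorem jacobiMeasure_eq (α β : ℝ) :
    jacobiMeasure α β = (volume.restrict (Set.Icc (-1 : ℝ) 1)).withDensity
      (fun x => ENNReal.ofReal (jacobiWeight α β x)) := rfl

theorem isFiniteMeasure_jacobiMeasure {α β : ℝ} (hα : -1 < α) (hβ : -1 < β) :
    IsFiniteMeasure (jacobiMeasure α β) := by
  refine isFiniteMeasure_withDensity_ofReal ?_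
  have := intervalIntegrable_jacobiWeight hα hβ
  rw [intervalIntegrable_iff_integrableOn_Icc_of_le (by norm_num)] at this
  exact this.2

theorem ae_jacobiMeasure_mem_Ioo (α β : ℝ) :
    ∀ᵐ x ∂(jacobiMeasure α β), x ∈ Set.Ioo (-1 : ℝ) 1 := by
  refine (withDensity_absolutelyContinuous _ _).ae_le ?_
  rw [← restrict_Ioo_eq_restrict_Icc]
  exact ae_restrict_mem measurableSet_Ioo

theorem ae_jacobiMeasure_mem_Icc (α β : ℝ) :
    ∀ᵐ x ∂(jacobiMeasure α β), x ∈ Set.Icc (-1 : ℝ) 1 :=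
  (ae_jacobiMeasure_mem_Ioo α β).mono fun _ hx => Set.Ioo_subset_Icc_self hx

theorem jacobiMeasure_restrict (α β : ℝ) :
    (jacobiMeasure α β).restrict (Set.Icc (-1 : ℝ) 1) = jacobiMeasure α β :=
  Measure.restrict_eq_self_of_ae_mem (ae_jacobiMeasure_mem_Icc α β)

theorem integral_jacobiMeasure (α β : ℝ) (g : ℝ → ℝ) :
    ∫ x, g x ∂(jacobiMeasure α β) = ∫ x in (-1 : ℝ)..1, jacobiWeight α β x * g x := by
  rw [jacobiMeasure_eq, integral_withDensity_eq_integral_toReal_smul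
    (measurable_jacobiWeight α β).ennreal_ofReal (by simp),
    intervalIntegral.integral_of_le (by norm_num), integral_Icc_eq_integral_Ioc]
  refine setIntegral_congr_fun measurableSet_Ioc fun x hx => ?_
  simp [ENNReal.toReal_ofReal (jacobiWeight_nonneg α β (Set.Ioc_subset_Icc_self hx))]

theorem integrable_jacobiMeasure_of_continuousOn {E : Type*} [NormedAddCommGroup E]
    {α β : ℝ} (hα : -1 < α) (hβ : -1 < β) {g : ℝ → E}
    (hg : ContinuousOn g (Set.Icc (-1) 1)) : Integrable g (jacobiMeasure α β) := by
  have := isFiniteMeasure_jacobiMeasure hα hβ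
  rw [← jacobiMeasure_restrict]
  exact hg.integrableOn_compact isCompact_Icc

/-- Divergence form of the operator: for g = p' the bracket is -L p. -/
theorem hasDerivAt_jacobiWeight_mul {α β x g' : ℝ} {g : ℝ → ℝ} (hx : x ∈ Set.Ioo (-1 : ℝ) 1)
    (hg : HasDerivAt g g' x) :
    HasDerivAt (fun x => jacobiWeight (α + 1) (β + 1) x * g x)
      (jacobiWeight α β x * ((1 - x ^ 2) * g' + (β - α - (α + β + 2) * x) * g x)) x := by
  have h1 : 0 < 1 - x := by linarith [hx.2]
  have h2 : 0 < 1 + x := by linarith [hx.1]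
  have d1 := ((hasDerivAt_id x).const_sub 1).rpow_const (p := α + 1) (Or.inl h1.ne')
  have d2 := ((hasDerivAt_id x).const_add 1).rpow_const (p := β + 1) (Or.inl h2.ne')
  refine ((d1.mul d2).mul hg).congr_deriv ?_
  simp only [jacobiWeight, id, Pi.mul_apply, add_sub_cancel_right, Real.rpow_add_one h1.ne',
    Real.rpow_add_one h2.ne']
  ring

theorem continuous_jacobiWeight {α β : ℝ} (hα : 0 ≤ α) (hβ : 0 ≤ β) :
    Continuous (jacobiWeight α β) :=
  ((continuous_const.sub continuous_id).rpow_const fun _ => Or.inr hα).mul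
    ((continuous_const.add continuous_id).rpow_const fun _ => Or.inr hβ)

/-! ### Symmetry and orthogonality -/

/-- The Jacobi operator is symmetric with respect to the Jacobi measure. -/
theorem integral_jacobiOp_mul {α β : ℝ} (hα : -1 < α) (hβ : -1 < β) (p q : ℝ[X]) :
    ∫ x, (jacobiOp α β p).eval x * q.eval x ∂(jacobiMeasure α β) =
      ∫ x, p.eval x * (jacobiOp α β q).eval x ∂(jacobiMeasure α β) := by
  have hint (g : ℝ[X]) : Integrable (fun x => g.eval x) (jacobiMeasure α β) :=
    integrable_jacobiMeasure_of_continuousOn hα hβ g.continuous.continuousOn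
  rw [← sub_eq_zero, ← integral_sub (by simpa using hint (jacobiOp α β p * q))
    (by simpa using hint (p * jacobiOp α β q)), integral_jacobiMeasure]
  -- Lagrange identity: the weighted Wronskian of p and q is a primitive of the difference of the
  -- integrands, and its weight vanishes at ±1 since α + 1, β + 1 > 0.
  have key := intervalIntegral.integral_eq_sub_of_hasDerivAt_of_le (a := -1) (b := 1)
    (f := fun x => jacobiWeight (α + 1) (β + 1) x *
      (p * derivative q - derivative p * q : ℝ[X]).eval x)
    (by norm_num)
    ((continuous_jacobiWeight (by linarith) (by linarith)).mul
      (Polynomial.continuous _)).continuousOn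
    (fun x hx => hasDerivAt_jacobiWeight_mul hx (Polynomial.hasDerivAt _ x))
    ((intervalIntegrable_jacobiWeight hα hβ).mul_continuousOn (by fun_prop))
  have e1 : jacobiWeight (α + 1) (β + 1) 1 = 0 := by
    simp [jacobiWeight, Real.zero_rpow (by linarith : α + 1 ≠ 0)]
  have e2 : jacobiWeight (α + 1) (β + 1) (-1) = 0 := by
    simp [jacobiWeight, Real.zero_rpow (by linarith : β + 1 ≠ 0)]
  rw [e1, e2, zero_mul, zero_mul, sub_zero] at key
  rw [← key]
  refine intervalIntegral.integral_congr fun x _ => ?_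
  simp only [jacobiOp_apply, derivative_sub, derivative_mul, eval_add, eval_mul, eval_sub, eval_pow,
    eval_X, eval_one, eval_C]
  ring

theorem integral_jacobiPoly_mul_of_ne {α β : ℝ} (hα : -1 < α) (hβ : -1 < β) {m n : ℕ}
    (hmn : m ≠ n) :
    ∫ x, (jacobiPoly α β m).eval x * (jacobiPoly α β n).eval x ∂(jacobiMeasure α β) = 0 := by
  have h := integral_jacobiOp_mul hα hβ (jacobiPoly α β m) (jacobiPoly α β n)
  simp only [jacobiOp_jacobiPoly, eval_smul, smul_eq_mul, mul_assoc, integral_const_mul,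
    mul_left_comm _ (jacobiEigenvalue α β n)] at h
  by_contra h0
  exact hmn (jacobiEigenvalue_injective hα hβ (mul_right_cancel₀ h0 h))

/-! ### Maximum principle -/

/-- A negative second derivative would make the point a local maximum as well, so f would be locally
constant and the second derivative zero. -/
theorem IsLocalMin.deriv_deriv_nonneg {f : ℝ → ℝ} {a : ℝ} (h : IsLocalMin f a)
    (hc : ContinuousAt f a) : 0 ≤ deriv (deriv f) a := by
  by_contra! hneg
  have h1 : IsLocalMin (fun x => -f x) a := by
    refine isLocalMin_of_deriv_deriv_pos ?_ ?_ hc.neg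
    · rw [show deriv (fun x => -f x) = fun x => -deriv f x from funext fun x => deriv.fun_neg,
        deriv.fun_neg]
      linarith
    · rw [deriv.fun_neg, h.deriv_eq_zero, neg_zero]
  have h2 : f =ᶠ[𝓝 a] fun _ => f a := by
    filter_upwards [h, h1] with x hx hx'
    exact le_antisymm (neg_le_neg_iff.1 hx') hx
  have h3 := h2.deriv.deriv_eq
  simp at h3
  exact hneg.ne h3

/-- In the interior p' = 0 and p'' ≥ 0. At the endpoints the second-order term vanishes, and the
remaining 2(α+1)p'(1) or -2(β+1)p'(-1) has the right sign, so no boundary condition in x is needed.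
-/
theorem eval_jacobiOp_nonpos_of_isMinOn {α β : ℝ} (hα : -1 < α) (hβ : -1 < β) {p : ℝ[X]} {x : ℝ}
    (hx : x ∈ Set.Icc (-1 : ℝ) 1) (hmin : IsMinOn (fun y => p.eval y) (Set.Icc (-1) 1) x) :
    (jacobiOp α β p).eval x ≤ 0 := by
  have hdir {y : ℝ} (hy : y ∈ Set.Icc (-1 : ℝ) 1) : 0 ≤ (y - x) * (derivative p).eval x := by
    have := hmin.localize.hasFDerivWithinAt_nonneg
      (p.hasDerivAt x).hasFDerivAt.hasFDerivWithinAt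
      (sub_mem_posTangentConeAt_of_segment_subset ((convex_Icc (-1 : ℝ) 1).segment_subset hx hy))
    simpa using this
  have h1 := hdir (y := 1) (by norm_num)
  have h2 := hdir (y := -1) (by norm_num)
  simp only [jacobiOp_apply, eval_add, eval_mul, eval_sub, eval_pow, eval_X, eval_one, eval_C]
  rcases hx.1.eq_or_lt with rfl | hx1
  · have h3 : 0 ≤ (β + 1) * (derivative p).eval (-1) := mul_nonneg (by linarith) (by linarith)
    linarith
  rcases hx.2.eq_or_lt with rfl | hx2
  · have h3 : 0 ≤ (α + 1) * -(derivative p).eval 1 := mul_nonneg (by linarith) (by linarith)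
    linarith
  have hloc : IsLocalMin (fun y => p.eval y) x := hmin.isLocalMin (Icc_mem_nhds hx1 hx2)
  have h3 := hloc.deriv_deriv_nonneg p.continuous.continuousAt
  have h4 := hloc.deriv_eq_zero
  have hd (q : ℝ[X]) : deriv (fun y => q.eval y) = fun y => (derivative q).eval y :=
    funext fun y => q.deriv
  rw [hd, hd] at h3
  rw [hd] at h4
  simp only at h3 h4
  rw [h4, mul_zero, add_zero]
  exact mul_nonpos_of_nonpos_of_nonneg (by nlinarith) h3

theorem jacobiPoly_zero (α β : ℝ) : jacobiPoly α β 0 = 1 := by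
  simp [jacobiPoly]

/-- Maximum principle: the Poisson extension of a polynomial that is nonnegative on `[-1, 1]`
is nonnegative, provided its value at `r = 0` is. -/
theorem poissonExtension_nonneg_of_coeff_zero {α β : ℝ} (hα : -1 < α) (hβ : -1 < β) (N : ℕ)
    (a : ℕ → ℝ)
    (h1 : ∀ x ∈ Set.Icc (-1 : ℝ) 1, 0 ≤ ∑ n ∈ Finset.range N, a n * (jacobiPoly α β n).eval x)
    (h0 : ∀ x : ℝ, 0 ≤ ∑ n ∈ Finset.range N, a n * 0 ^ n * (jacobiPoly α β n).eval x)
    {r x : ℝ} (hr : r ∈ Set.Icc (0 : ℝ) 1) (hx : x ∈ Set.Icc (-1 : ℝ) 1) :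
    0 ≤ ∑ n ∈ Finset.range N, a n * r ^ n * (jacobiPoly α β n).eval x := by
  suffices h : ∀ ε > 0, -ε ≤ ∑ n ∈ Finset.range N, a n * r ^ n * (jacobiPoly α β n).eval x by
    refine le_of_forall_pos_le_add fun ε hε => ?_
    linarith [h ε hε]
  intro ε hε
  -- The tilt by -ε r makes the inequality strict: at a minimum with 0 < r < 1 it forces u_r = ε >
  -- 0.
  obtain ⟨z, hz, hmin⟩ := (isCompact_Icc.prod isCompact_Icc).exists_isMinOn
    (f := fun z : ℝ × ℝ => ∑ n ∈ Finset.range N, a n * z.1 ^ n * (jacobiPoly α β n).eval z.2 -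
      ε * z.1) ⟨(r, x), hr, hx⟩ (by
        refine Continuous.continuousOn (.sub (continuous_finsetSum _ fun n _ => ?_)
          (continuous_const.mul continuous_fst))
        exact (continuous_const.mul (continuous_fst.pow n)).mul
          ((jacobiPoly α β n).continuous.comp continuous_snd))
  obtain ⟨s, y⟩ := z
  obtain ⟨hs, hy⟩ : s ∈ Set.Icc (0 : ℝ) 1 ∧ y ∈ Set.Icc (-1 : ℝ) 1 := hz
  have hle {t w : ℝ} (ht : t ∈ Set.Icc (0 : ℝ) 1) (hw : w ∈ Set.Icc (-1 : ℝ) 1) :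
      ∑ n ∈ Finset.range N, a n * s ^ n * (jacobiPoly α β n).eval y - ε * s ≤
      ∑ n ∈ Finset.range N, a n * t ^ n * (jacobiPoly α β n).eval w - ε * t :=
    hmin (a := (t, w)) ⟨ht, hw⟩
  have hrx := hle hr hx
  rcases hs.1.eq_or_lt with rfl | hs0
  · nlinarith [h0 y, mul_nonneg hε.le hr.1]
  rcases hs.2.eq_or_lt with rfl | hs1
  · have := h1 y hy
    simp only [one_pow, mul_one] at hrx
    nlinarith [mul_nonneg hε.le hr.1]
  exfalso
  have hX := eval_jacobiOp_nonpos_of_isMinOn hα hβ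
    (p := ∑ n ∈ Finset.range N, (a n * s ^ n) • jacobiPoly α β n) hy (fun w hw => by
      have := hle hs hw
      simpa [eval_finsetSum] using this)
  have hR : IsLocalMin (fun t => (∑ n ∈ Finset.range N,
      C (a n * (jacobiPoly α β n).eval y) * X ^ n - C ε * X : ℝ[X]).eval t) s := by
    refine IsMinOn.isLocalMin (s := Set.Icc 0 1) (fun t ht => ?_) (Icc_mem_nhds hs0 hs1)
    have := hle ht hy
    simp only [Set.mem_ofPred_eq, eval_sub, eval_finsetSum, eval_mul, eval_C, eval_pow, eval_X,
      mul_right_comm _ (eval _ _)]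
    exact this
  have hR1 := hR.deriv_eq_zero
  have hR2 := hR.deriv_deriv_nonneg (Polynomial.continuous _).continuousAt
  have hd (q : ℝ[X]) : deriv (fun y => q.eval y) = fun y => (derivative q).eval y :=
    funext fun y => q.deriv
  rw [hd, hd] at hR2
  rw [hd] at hR1
  simp only [map_sum, map_smul, jacobiOp_jacobiPoly, eval_finsetSum, eval_smul, smul_eq_mul] at hX
  simp only [derivative_sub, derivative_sum, derivative_C_mul, derivative_X_pow, derivative_X,
    eval_sub, eval_finsetSum, eval_mul, eval_C, eval_pow, eval_X, mul_one,
    derivative_C, sub_zero] at hR1 hR2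
  -- The equation s² u_ss + (α+β+2) s u_s = L u. Its left side is at least (α+β+2) s ε > 0, its
  -- right side at most 0.
  have key : s ^ 2 * (∑ n ∈ Finset.range N, a n * (jacobiPoly α β n).eval y *
      (n * (((n - 1 : ℕ) : ℝ) * s ^ (n - 1 - 1)))) + (α + β + 2) * s *
      (∑ n ∈ Finset.range N, a n * (jacobiPoly α β n).eval y * (n * s ^ (n - 1))) =
      ∑ n ∈ Finset.range N, a n * s ^ n *
        (jacobiEigenvalue α β n * (jacobiPoly α β n).eval y) := by
    rw [Finset.mul_sum, Finset.mul_sum, ← Finset.sum_add_distrib]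
    refine Finset.sum_congr rfl fun n _ => ?_
    rw [jacobiEigenvalue]
    rcases n with _ | _ | n
    · simp
    · simp only [zero_add, Nat.sub_self, Nat.cast_zero, Nat.cast_one, pow_zero, pow_one]
      ring
    · simp only [Nat.add_sub_cancel, Nat.cast_add, Nat.cast_one]
      ring
  have h2 := mul_nonneg (sq_nonneg s) hR2
  have h3 : 0 < (α + β + 2) * s * ε := by
    have : 0 < α + β + 2 := by linarith
    positivity
  have h4 := congrArg (fun t => (α + β + 2) * s * t) hR1
  simp only [mul_sub, mul_zero] at h4
  linarith

/-- Orthogonality to P_0 = 1 leaves only the constant mode, which `0 ^ n` selects (also giving zero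
when N = 0). This provides the sign at r = 0. -/
theorem coeff_zero_mul_eq_integral {α β : ℝ} (hα : -1 < α) (hβ : -1 < β) (N : ℕ) (a : ℕ → ℝ) :
    ∫ x, ∑ n ∈ Finset.range N, a n * (jacobiPoly α β n).eval x ∂(jacobiMeasure α β) =
      (∑ n ∈ Finset.range N, a n * 0 ^ n) * (jacobiMeasure α β).real Set.univ := by
  rw [integral_finsetSum _ fun n _ => integrable_jacobiMeasure_of_continuousOn hα hβ (by fun_prop),
    Finset.sum_mul]
  refine Finset.sum_congr rfl fun n _ => ?_
  rw [integral_const_mul]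
  rcases n.eq_zero_or_pos with rfl | hn
  · simp [jacobiPoly_zero]
  · have h := integral_jacobiPoly_mul_of_ne hα hβ hn.ne'
    simp only [jacobiPoly_zero, eval_one, mul_one] at h
    simp [h, hn.ne']

theorem jacobiMeasure_real_univ_pos {α β : ℝ} (hα : -1 < α) (hβ : -1 < β) :
    0 < (jacobiMeasure α β).real Set.univ := by
  have h : (jacobiMeasure α β).real Set.univ = ∫ _, (1 : ℝ) ∂(jacobiMeasure α β) := by simp
  rw [h, integral_jacobiMeasure]
  refine intervalIntegral.intervalIntegral_pos_of_pos_on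
    ((intervalIntegrable_jacobiWeight hα hβ).mul_const 1) (fun x hx => ?_) (by norm_num)
  rw [mul_one]
  exact mul_pos (Real.rpow_pos_of_pos (by linarith [hx.2]) _)
    (Real.rpow_pos_of_pos (by linarith [hx.1]) _)

/-- The Poisson extension of a polynomial that is nonnegative on `[-1, 1]` is nonnegative. -/
theorem poissonExtension_nonneg {α β : ℝ} (hα : -1 < α) (hβ : -1 < β) (N : ℕ) (a : ℕ → ℝ)
    (h1 : ∀ x ∈ Set.Icc (-1 : ℝ) 1, 0 ≤ ∑ n ∈ Finset.range N, a n * (jacobiPoly α β n).eval x)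
    {r x : ℝ} (hr : r ∈ Set.Icc (0 : ℝ) 1) (hx : x ∈ Set.Icc (-1 : ℝ) 1) :
    0 ≤ ∑ n ∈ Finset.range N, a n * r ^ n * (jacobiPoly α β n).eval x := by
  refine poissonExtension_nonneg_of_coeff_zero hα hβ N a h1 (fun y => ?_) hr hx
  have h2 : 0 ≤ (∑ n ∈ Finset.range N, a n * 0 ^ n) * (jacobiMeasure α β).real Set.univ := by
    rw [← coeff_zero_mul_eq_integral hα hβ]
    exact integral_nonneg_of_ae ((ae_jacobiMeasure_mem_Icc α β).mono fun x hx => h1 x hx)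
  have h3 := nonneg_of_mul_nonneg_left h2 (jacobiMeasure_real_univ_pos hα hβ)
  refine h3.trans_eq (Finset.sum_congr rfl fun n _ => ?_)
  rcases n.eq_zero_or_pos with rfl | hn
  · simp [jacobiPoly_zero]
  · simp [hn.ne']

/-! ### Growth of the Jacobi polynomials -/

/-- Integrating the divergence form of the equation from x to 1, with (1+t)^β ≤ 2^|β|, bounds
(1-x)^(α+1) (1+x)^(β+1) p'(x) by a multiple of (1-x)^(α+1), which cancels. -/
theorem derivative_eval_le_of_jacobiOp_eq {α β l M : ℝ} (hα : -1 < α) (hβ : -1 < β) (hl : 0 ≤ l)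
    {p : ℝ[X]} (hp : jacobiOp α β p = l • p)
    (hM : ∀ x ∈ Set.Icc (-1 : ℝ) 1, |p.eval x| ≤ M) {x : ℝ} (hx : x ∈ Set.Icc (0 : ℝ) 1) :
    (derivative p).eval x ≤ l * M * (2 ^ |β| / (α + 1)) := by
  have hα1 : 0 < α + 1 := by linarith
  have hM0 : 0 ≤ M := (abs_nonneg _).trans (hM 0 (by norm_num))
  have hode (y : ℝ) : (1 - y ^ 2) * (derivative (derivative p)).eval y +
      (β - α - (α + β + 2) * y) * (derivative p).eval y = -(l * p.eval y) := by
    have := congrArg (eval y) hp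
    simp only [jacobiOp_apply, eval_add, eval_mul, eval_sub, eval_pow, eval_X, eval_one, eval_C,
      eval_smul, smul_eq_mul] at this
    linear_combination -this
  have h2 : (1 : ℝ) ≤ 2 ^ |β| := Real.one_le_rpow (by norm_num) (abs_nonneg β)
  -- At x = 1 nothing can be cancelled, but there the equation reads 2(α+1)p'(1) = l p(1).
  rcases hx.2.eq_or_lt with rfl | hx1
  · have h1 := hode 1
    have h3 := (le_abs_self _).trans (hM 1 (by norm_num))
    have h4 := mul_le_mul_of_nonneg_left h3 hl
    have h5 : l * M ≤ l * M * 2 ^ |β| := le_mul_of_one_le_right (mul_nonneg hl hM0) h2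
    have h6 : (α + 1) * (2 * (derivative p).eval 1) ≤ l * M := by linarith
    rw [← mul_div_assoc, le_div_iff₀ hα1]
    have h7 : 0 ≤ l * M * 2 ^ |β| := by positivity
    linarith
  obtain ⟨K, hK⟩ : ∃ K, K = l * M * (2 ^ |β| / (α + 1)) := ⟨_, rfl⟩
  rw [← hK]
  have hK' : K * (α + 1) = l * M * 2 ^ |β| := by rw [hK]; field_simp
  have hder {y : ℝ} (hy : y ∈ Set.Ioo (0 : ℝ) 1) : HasDerivAt (fun y => K * (1 - y) ^ (α + 1) -
      jacobiWeight (α + 1) (β + 1) y * (derivative p).eval y)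
      (-(K * (α + 1) * (1 - y) ^ α) + jacobiWeight α β y * (l * p.eval y)) y := by
    have d1 := (((hasDerivAt_id y).const_sub 1).rpow_const (p := α + 1)
      (Or.inl (by simp only [id]; linarith [hy.2]))).const_mul K
    have d2 := hasDerivAt_jacobiWeight_mul (α := α) (β := β) ⟨by linarith [hy.1], hy.2⟩
      ((derivative p).hasDerivAt y)
    refine (d1.sub d2).congr_deriv ?_
    rw [hode, add_sub_cancel_right]
    simp only [id]
    ring
  -- The integration is phrased as monotonicity: this function vanishes at 1, and K makes its
  -- derivative nonpositive.
  have hanti : AntitoneOn (fun y => K * (1 - y) ^ (α + 1) -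
      jacobiWeight (α + 1) (β + 1) y * (derivative p).eval y) (Set.Icc 0 1) := by
    refine antitoneOn_of_deriv_nonpos (convex_Icc 0 1) ?_ ?_ ?_
    · refine Continuous.continuousOn (.sub (continuous_const.mul
        ((continuous_const.sub continuous_id).rpow_const fun _ => Or.inr hα1.le)) ?_)
      exact (continuous_jacobiWeight hα1.le (by linarith)).mul (Polynomial.continuous _)
    · rw [interior_Icc]
      exact fun y hy => (hder hy).differentiableAt.differentiableWithinAt
    · rw [interior_Icc]
      intro y hy
      rw [(hder hy).deriv, hK']
      have e1 : (1 + y) ^ β ≤ 2 ^ |β| :=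
        rpow_le_two_rpow_abs (by linarith [hy.1]) (by linarith [hy.2]) β
      have e2 : 0 ≤ (1 - y) ^ α := Real.rpow_nonneg (by linarith [hy.2]) _
      have e3 : 0 ≤ (1 + y) ^ β := Real.rpow_nonneg (by linarith [hy.1]) _
      have e4 := (le_abs_self _).trans (hM y ⟨by linarith [hy.1], hy.2.le⟩)
      have e5 : jacobiWeight α β y * (l * p.eval y) ≤ jacobiWeight α β y * (l * M) := by
        rw [jacobiWeight]; gcongr
      have e6 : jacobiWeight α β y * (l * M) ≤ (1 - y) ^ α * 2 ^ |β| * (l * M) := by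
        rw [jacobiWeight]; gcongr
      linarith
  have h3 := hanti hx (Set.right_mem_Icc.2 zero_le_one) hx.2
  simp only [jacobiWeight, sub_self, Real.zero_rpow hα1.ne', zero_mul, mul_zero] at h3
  have h4 : 0 < (1 - x) ^ (α + 1) := Real.rpow_pos_of_pos (by linarith) _
  have h5 : 1 ≤ (1 + x) ^ (β + 1) := Real.one_le_rpow (by linarith [hx.1]) (by linarith)
  have h6 : (1 + x) ^ (β + 1) * (derivative p).eval x ≤ K := by
    refine le_of_mul_le_mul_left ?_ h4
    linarith
  rcases le_total ((derivative p).eval x) 0 with h | h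
  · refine h.trans ?_
    rw [hK]; positivity
  · exact (le_mul_of_one_le_left h h5).trans h6

/-- Transfers the derivative bound from [0, 1] to [-1, 0]. -/
theorem jacobiOp_comp_neg_X (α β : ℝ) (p : ℝ[X]) :
    jacobiOp β α (p.comp (-X)) = (jacobiOp α β p).comp (-X) := by
  simp only [jacobiOp_apply, derivative_comp, derivative_neg, derivative_X, derivative_mul,
    add_comp, mul_comp, sub_comp, pow_comp, X_comp, one_comp, C_comp, C_add, C_sub,
    derivative_one, neg_zero, zero_mul]
  ring

/-- A Markov-type inequality for eigenfunctions of the Jacobi operator. -/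
theorem abs_derivative_eval_le_of_jacobiOp_eq {α β l M : ℝ} (hα : -1 < α) (hβ : -1 < β)
    (hl : 0 ≤ l) {p : ℝ[X]} (hp : jacobiOp α β p = l • p)
    (hM : ∀ x ∈ Set.Icc (-1 : ℝ) 1, |p.eval x| ≤ M) {x : ℝ} (hx : x ∈ Set.Icc (-1 : ℝ) 1) :
    |(derivative p).eval x| ≤ l * M * (2 ^ |β| / (α + 1) + 2 ^ |α| / (β + 1)) := by
  have hM0 : 0 ≤ M := (abs_nonneg _).trans (hM 0 (by norm_num))
  have hα1 : 0 < α + 1 := by linarith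
  have hβ1 : 0 < β + 1 := by linarith
  have e1 : 0 ≤ l * M * (2 ^ |β| / (α + 1)) := by positivity
  have e2 : 0 ≤ l * M * (2 ^ |α| / (β + 1)) := by positivity
  have hpn : jacobiOp α β (-p) = l • (-p) := by rw [map_neg, hp, smul_neg]
  have hMn : ∀ x ∈ Set.Icc (-1 : ℝ) 1, |(-p).eval x| ≤ M := fun x hx => by
    rw [eval_neg, abs_neg]; exact hM x hx
  have hc {q : ℝ[X]} (hq : jacobiOp α β q = l • q) :
      jacobiOp β α (q.comp (-X)) = l • q.comp (-X) := by
    rw [jacobiOp_comp_neg_X, hq, smul_comp]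
  have hMc {q : ℝ[X]} (hq : ∀ x ∈ Set.Icc (-1 : ℝ) 1, |q.eval x| ≤ M) :
      ∀ x ∈ Set.Icc (-1 : ℝ) 1, |(q.comp (-X)).eval x| ≤ M := fun x hx => by
    rw [eval_comp, eval_neg, eval_X]
    exact hq _ ⟨by linarith [hx.2], by linarith [hx.1]⟩
  rw [mul_add, abs_le]
  rcases le_total 0 x with h | h
  · have h1 := derivative_eval_le_of_jacobiOp_eq hα hβ hl hp hM ⟨h, hx.2⟩
    have h2 := derivative_eval_le_of_jacobiOp_eq hα hβ hl hpn hMn ⟨h, hx.2⟩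
    rw [derivative_neg, eval_neg] at h2
    constructor <;> linarith
  · have hx' : -x ∈ Set.Icc (0 : ℝ) 1 := ⟨by linarith, by linarith [hx.1]⟩
    have h1 := derivative_eval_le_of_jacobiOp_eq hβ hα hl (hc hp) (hMc hM) hx'
    have h2 := derivative_eval_le_of_jacobiOp_eq hβ hα hl (hc hpn) (hMc hMn) hx'
    simp only [derivative_comp, derivative_neg, derivative_X, eval_mul, eval_neg, eval_one,
      eval_comp, eval_X, neg_neg] at h1 h2
    constructor <;> linarith

theorem rpow_abs_le_rpow {d t : ℝ} (hd : 0 < d) (hd2 : d ≤ 1 / 2) (hdt : d ≤ t) (ht : t ≤ 2)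
    (γ : ℝ) : d ^ |γ| ≤ t ^ γ := by
  have ht0 : 0 < t := hd.trans_le hdt
  rcases le_total 0 γ with h | h
  · rw [abs_of_nonneg h]
    exact Real.rpow_le_rpow hd.le hdt h
  · rw [abs_of_nonpos h, ← neg_neg γ, Real.rpow_neg ht0.le, ← Real.inv_rpow ht0.le, neg_neg]
    refine Real.rpow_le_rpow hd.le (hd2.trans ?_) (by linarith)
    rw [one_div]
    exact inv_anti₀ ht0 ht

/-- A Nikolskii-type inequality for polynomials with a bound on the derivative. -/
theorem sq_mul_rpow_le_integral_sq {α β B : ℝ} (hα : -1 < α) (hβ : -1 < β) (hB : 0 ≤ B)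
    {p : ℝ[X]} {x₀ : ℝ} (hx₀ : x₀ ∈ Set.Icc (-1 : ℝ) 1)
    (hp : ∀ x ∈ Set.Icc (-1 : ℝ) 1, |(derivative p).eval x| ≤ B * |p.eval x₀|) :
    p.eval x₀ ^ 2 * (6 * (1 + B)) ^ (-(1 + |α| + |β|)) ≤
      4 * ∫ x, p.eval x ^ 2 ∂(jacobiMeasure α β) := by
  obtain ⟨d, hd⟩ : ∃ d, d = (6 * (1 + B))⁻¹ := ⟨_, rfl⟩
  have hd0 : 0 < d := by rw [hd]; positivity
  have hdB : 6 * (1 + B) * d = 1 := by rw [hd]; field_simp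
  have hd6 : d ≤ 1 / 6 := by nlinarith [mul_nonneg hB hd0.le]
  -- An interval of length d within 2d of x₀ and at distance at least d from ±1: there |p| ≥
  -- |p(x₀)|/2, since 2Bd ≤ 1/3, and the weight is at least d^(|α|+|β|).
  obtain ⟨a, ha1, ha2, ha3⟩ : ∃ a, -1 + d ≤ a ∧ a + d ≤ 1 - d ∧
      ∀ x ∈ Set.Icc a (a + d), |x - x₀| ≤ 2 * d := by
    rcases le_total x₀ 0 with h | h
    · refine ⟨x₀ + d, by linarith [hx₀.1], by linarith, fun x hx => ?_⟩
      rw [abs_le]; constructor <;> linarith [hx.1, hx.2]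
    · refine ⟨x₀ - 2 * d, by linarith, by linarith [hx₀.2], fun x hx => ?_⟩
      rw [abs_le]; constructor <;> linarith [hx.1, hx.2]
  have hsub : Set.Icc a (a + d) ⊆ Set.Icc (-1 : ℝ) 1 :=
    Set.Icc_subset_Icc (by linarith) (by linarith)
  have hlow {x : ℝ} (hx : x ∈ Set.Icc a (a + d)) :
      d ^ (|α| + |β|) * (p.eval x₀ ^ 2 / 4) ≤ jacobiWeight α β x * p.eval x ^ 2 := by
    have h1 : |p.eval x - p.eval x₀| ≤ B * |p.eval x₀| * |x - x₀| :=
      (convex_Icc (-1 : ℝ) 1).norm_image_sub_le_of_norm_deriv_le (f := fun x => p.eval x)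
        (fun y _ => p.differentiableAt) (fun y hy => by rw [p.deriv]; exact hp y hy) hx₀ (hsub hx)
    have h2 : B * |p.eval x₀| * |x - x₀| ≤ B * |p.eval x₀| * (2 * d) := by
      gcongr; exact ha3 x hx
    have h3 : B * d ≤ 1 / 6 := by linarith
    have h4 : B * d * |p.eval x₀| ≤ 1 / 6 * |p.eval x₀| := by gcongr
    have h5 : |p.eval x₀| - |p.eval x| ≤ |p.eval x - p.eval x₀| := by
      rw [abs_sub_comm]; exact abs_sub_abs_le_abs_sub _ _
    have h6 : |p.eval x₀| / 2 ≤ |p.eval x| := by linarith [abs_nonneg (p.eval x₀)]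
    have h7 : p.eval x₀ ^ 2 / 4 ≤ p.eval x ^ 2 := by
      rw [← sq_abs (p.eval x), ← sq_abs (p.eval x₀)]
      nlinarith [abs_nonneg (p.eval x₀)]
    have h8 : d ^ (|α| + |β|) ≤ jacobiWeight α β x := by
      rw [Real.rpow_add hd0, jacobiWeight]
      refine mul_le_mul (rpow_abs_le_rpow hd0 (by linarith) ?_ ?_ α)
        (rpow_abs_le_rpow hd0 (by linarith) ?_ ?_ β) (by positivity)
        (Real.rpow_nonneg ?_ _) <;> linarith [hx.1, hx.2]
    exact mul_le_mul h8 h7 (by positivity) (jacobiWeight_nonneg α β (hsub hx))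
  have hint : IntervalIntegrable (fun x => jacobiWeight α β x * p.eval x ^ 2) volume (-1) 1 :=
    (intervalIntegrable_jacobiWeight hα hβ).mul_continuousOn (by fun_prop)
  have h1 : ∫ x in a..(a + d), jacobiWeight α β x * p.eval x ^ 2 ≤
      ∫ x in (-1 : ℝ)..1, jacobiWeight α β x * p.eval x ^ 2 := by
    refine intervalIntegral.integral_mono_interval (by linarith) (by linarith) (by linarith) ?_ hint
    filter_upwards [ae_restrict_mem measurableSet_Ioc] with x hx
    exact mul_nonneg (jacobiWeight_nonneg α β (Set.Ioc_subset_Icc_self hx)) (sq_nonneg _)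
  have h2 : ∫ _ in a..(a + d), d ^ (|α| + |β|) * (p.eval x₀ ^ 2 / 4) ≤
      ∫ x in a..(a + d), jacobiWeight α β x * p.eval x ^ 2 := by
    refine intervalIntegral.integral_mono_on (by linarith) intervalIntegrable_const
      (hint.mono_set ?_) fun x hx => hlow hx
    rw [Set.uIcc_of_le (by linarith), Set.uIcc_of_le (by norm_num)]
    exact hsub
  rw [intervalIntegral.integral_const, add_sub_cancel_left, smul_eq_mul] at h2
  rw [integral_jacobiMeasure, Real.rpow_neg (by positivity), ← Real.inv_rpow (by positivity), ← hd,
    add_assoc, Real.rpow_add hd0, Real.rpow_one]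
  linarith

/-- Polynomial growth of the normalized Jacobi polynomials on `[-1, 1]`. -/
theorem exists_jacobiPoly_growth {α β : ℝ} (hα : -1 < α) (hβ : -1 < β) :
    ∃ (C : ℝ) (k : ℕ), 0 ≤ C ∧ ∀ n : ℕ, 0 < jacobiNormSq α β n ∧
      ∀ x ∈ Set.Icc (-1 : ℝ) 1, ∀ y ∈ Set.Icc (-1 : ℝ) 1,
        |(jacobiPoly α β n).eval x| * |(jacobiPoly α β n).eval y| ≤
          C * (n + 1) ^ k * jacobiNormSq α β n := by
  obtain ⟨b, hb⟩ : ∃ b, b = 2 ^ |β| / (α + 1) + 2 ^ |α| / (β + 1) := ⟨_, rfl⟩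
  have hα1 : 0 < α + 1 := by linarith
  have hβ1 : 0 < β + 1 := by linarith
  have hb0 : 0 ≤ b := by rw [hb]; positivity
  obtain ⟨k, hk⟩ := exists_nat_ge (1 + |α| + |β|)
  obtain ⟨A, hA⟩ : ∃ A, A = 6 * (1 + (α + β + 3) * b) := ⟨_, rfl⟩
  have hab : 0 ≤ α + β + 3 := by linarith
  have hA0 : 0 ≤ A := by rw [hA]; positivity
  refine ⟨4 * A ^ k, 2 * k, by positivity, fun n => ?_⟩
  have hl : 0 ≤ jacobiEigenvalue α β n := by
    rw [jacobiEigenvalue]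
    rcases n.eq_zero_or_pos with rfl | hn
    · simp
    · have : (1 : ℝ) ≤ n := by exact_mod_cast hn
      exact mul_nonneg (by linarith) (by linarith)
  obtain ⟨x₀, hx₀, hmax⟩ := isCompact_Icc.exists_isMaxOn (s := Set.Icc (-1 : ℝ) 1)
    (f := fun x => |(jacobiPoly α β n).eval x|) ⟨0, by norm_num⟩
    (jacobiPoly α β n).continuous.abs.continuousOn
  have hM (x : ℝ) (hx : x ∈ Set.Icc (-1 : ℝ) 1) :
    |(jacobiPoly α β n).eval x| ≤ |(jacobiPoly α β n).eval x₀| := hmax hx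
  have h1 := sq_mul_rpow_le_integral_sq hα hβ (mul_nonneg hl hb0) hx₀ fun x hx => by
    have := abs_derivative_eval_le_of_jacobiOp_eq hα hβ hl (jacobiOp_jacobiPoly α β n) hM hx
    rw [← hb] at this
    rwa [mul_right_comm]
  change _ ≤ 4 * jacobiNormSq α β n at h1
  have hD : 1 ≤ 6 * (1 + jacobiEigenvalue α β n * b) := by nlinarith [mul_nonneg hl hb0]
  have hD2 : 6 * (1 + jacobiEigenvalue α β n * b) ≤ A * (n + 1) ^ 2 := by
    have hle : jacobiEigenvalue α β n ≤ (α + β + 3) * (n + 1) ^ 2 := by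
      rw [jacobiEigenvalue]
      have hn : (0 : ℝ) ≤ n := n.cast_nonneg
      nlinarith [mul_nonneg hn (by linarith : 0 ≤ α + β + 2)]
    have h1n : (1 : ℝ) ≤ ((n : ℝ) + 1) ^ 2 := one_le_pow₀ (by linarith [n.cast_nonneg (α := ℝ)])
    have := mul_le_mul_of_nonneg_right hle hb0
    rw [hA]
    linarith
  rw [Real.rpow_neg (by linarith), ← div_eq_mul_inv, div_le_iff₀ (Real.rpow_pos_of_pos
    (by linarith) _)] at h1
  have h2 : (6 * (1 + jacobiEigenvalue α β n * b)) ^ (1 + |α| + |β|) ≤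
      A ^ k * ((n : ℝ) + 1) ^ (2 * k) := by
    refine (Real.rpow_le_rpow_of_exponent_le hD hk).trans ?_
    rw [Real.rpow_natCast, pow_mul, ← mul_pow]
    exact pow_le_pow_left₀ (by linarith) hD2 k
  have h3 : 0 < (6 * (1 + jacobiEigenvalue α β n * b)) ^ (1 + |α| + |β|) :=
    Real.rpow_pos_of_pos (by linarith) _
  -- P_n(1) > 0 makes the maximum positive, and the lower bound then gives h_n > 0.
  have h4 : 0 < |(jacobiPoly α β n).eval x₀| := by
    refine lt_of_lt_of_le ?_ (hM 1 (by norm_num))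
    rw [jacobiPoly_eval_one]
    exact abs_pos.2 (ringChoose_pos n (by linarith)).ne'
  have h5 : 0 < (jacobiPoly α β n).eval x₀ ^ 2 := by rw [← sq_abs]; positivity
  have h6 : 0 < jacobiNormSq α β n := by
    have := pos_of_mul_pos_left (h5.trans_le h1) h3.le
    linarith
  refine ⟨h6, fun x hx y hy => ?_⟩
  calc _ ≤ |(jacobiPoly α β n).eval x₀| * |(jacobiPoly α β n).eval x₀| :=
        mul_le_mul (hM x hx) (hM y hy) (abs_nonneg _) (abs_nonneg _)
    _ = (jacobiPoly α β n).eval x₀ ^ 2 := by rw [← sq, sq_abs]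
    _ ≤ _ := h1
    _ ≤ 4 * jacobiNormSq α β n * (A ^ k * ((n : ℝ) + 1) ^ (2 * k)) := by gcongr
    _ = _ := by ring

/-! ### The Jacobi-Poisson kernel -/

/-- The `n`-th term `r^n P_n(x) P_n(y) / h_n` of the Jacobi-Poisson kernel. -/
noncomputable def jacobiKernelTerm (α β r x y : ℝ) (n : ℕ) : ℝ :=
  r ^ n * ((jacobiPoly α β n).eval x * (jacobiPoly α β n).eval y) / jacobiNormSq α β n

/-- The Jacobi-Poisson kernel. -/
noncomputable def jacobiKernel (α β r x y : ℝ) : ℝ := ∑' n, jacobiKernelTerm α β r x y n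

theorem jacobiKernel_comm (α β r x y : ℝ) : jacobiKernel α β r x y = jacobiKernel α β r y x := by
  simp only [jacobiKernel, jacobiKernelTerm, mul_comm]

theorem exists_summable_bound_jacobiKernelTerm {α β : ℝ} (hα : -1 < α) (hβ : -1 < β) {r : ℝ}
    (hr0 : 0 < r) (hr1 : r < 1) :
    ∃ u : ℕ → ℝ, Summable u ∧ ∀ n, ∀ x ∈ Set.Icc (-1 : ℝ) 1, ∀ y ∈ Set.Icc (-1 : ℝ) 1,
      |jacobiKernelTerm α β r x y n| ≤ u n := by
  obtain ⟨C, k, hC, h⟩ := exists_jacobiPoly_growth hα hβ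
  -- The bound C (n+1)^k r^n, written as a shift of n^k r^n.
  refine ⟨fun n => C / r * (((n + 1 : ℕ) : ℝ) ^ k * r ^ (n + 1)), ?_, fun n x hx y hy => ?_⟩
  · have hs : Summable fun n : ℕ => (n : ℝ) ^ k * r ^ n :=
      summable_pow_mul_geometric_of_norm_lt_one k (by rwa [Real.norm_of_nonneg hr0.le])
    exact ((summable_nat_add_iff (f := fun n : ℕ => (n : ℝ) ^ k * r ^ n) 1).2 hs).mul_left _
  · obtain ⟨hn, hb⟩ := h n
    rw [jacobiKernelTerm, abs_div, abs_of_pos hn, div_le_iff₀ hn, abs_mul,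
      abs_of_pos (pow_pos hr0 n), abs_mul]
    calc _ ≤ r ^ n * (C * (n + 1) ^ k * jacobiNormSq α β n) := by
          exact mul_le_mul_of_nonneg_left (hb x hx y hy) (by positivity)
      _ = _ := by push_cast; rw [pow_succ r]; field_simp

theorem continuousOn_jacobiKernel {α β : ℝ} (hα : -1 < α) (hβ : -1 < β) {r : ℝ}
    (hr0 : 0 < r) (hr1 : r < 1) :
    ContinuousOn (fun z : ℝ × ℝ => jacobiKernel α β r z.1 z.2)
      (Set.Icc (-1) 1 ×ˢ Set.Icc (-1) 1) := by
  obtain ⟨u, hu, h⟩ := exists_summable_bound_jacobiKernelTerm hα hβ hr0 hr1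
  refine continuousOn_tsum (fun n => ?_) hu fun n z hz => h n z.1 hz.1 z.2 hz.2
  unfold jacobiKernelTerm
  fun_prop

theorem continuousOn_jacobiKernel_right {α β : ℝ} (hα : -1 < α) (hβ : -1 < β) {r : ℝ}
    (hr0 : 0 < r) (hr1 : r < 1) {x : ℝ} (hx : x ∈ Set.Icc (-1 : ℝ) 1) :
    ContinuousOn (jacobiKernel α β r x) (Set.Icc (-1) 1) :=
  (continuousOn_jacobiKernel hα hβ hr0 hr1).comp (f := fun y => (x, y)) (by fun_prop)
    fun _ hy => ⟨hx, hy⟩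

/-! ### Abel means as kernel integrals -/

section AbelMeans

variable {𝕜 : Type*} [RCLike 𝕜] {α β : ℝ}

theorem integrable_smul_jacobiMeasure {g : ℝ → ℝ} {f : ℝ → 𝕜}
    (hg : ContinuousOn g (Set.Icc (-1) 1)) (hf : Integrable f (jacobiMeasure α β)) :
    Integrable (fun y => g y • f y) (jacobiMeasure α β) := by
  rw [← jacobiMeasure_restrict] at hf ⊢
  exact IntegrableOn.continuousOn_smul hf hg isCompact_Icc

theorem jacobiAbelTerm_eq_integral (f : ℝ → 𝕜) (r x : ℝ) (n : ℕ) :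
    jacobiAbelTerm α β f r x n =
      ∫ y, jacobiKernelTerm α β r x y n • f y ∂(jacobiMeasure α β) := by
  rw [jacobiAbelTerm, jacobiCoeff, smul_smul, ← integral_smul]
  refine integral_congr_ae (.of_forall fun y => ?_)
  simp only [smul_smul, jacobiKernelTerm]
  congr 1
  ring

/-- The bound is uniform in x, so it serves both to exchange sum and integral and to make the Abel
means continuous. -/
theorem exists_summable_bound_jacobiAbelTerm (hα : -1 < α) (hβ : -1 < β) {r : ℝ}
    (hr0 : 0 < r) (hr1 : r < 1) {f : ℝ → 𝕜} (hf : Integrable f (jacobiMeasure α β)) :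
    ∃ v : ℕ → ℝ, Summable v ∧ ∀ n, ∀ x ∈ Set.Icc (-1 : ℝ) 1,
      ∫ y, ‖jacobiKernelTerm α β r x y n • f y‖ ∂(jacobiMeasure α β) ≤ v n := by
  obtain ⟨u, hu, h⟩ := exists_summable_bound_jacobiKernelTerm hα hβ hr0 hr1
  refine ⟨fun n => u n * ∫ y, ‖f y‖ ∂(jacobiMeasure α β), hu.mul_right _, fun n x hx => ?_⟩
  simp only [← integral_const_mul]
  refine integral_mono_of_nonneg (.of_forall fun y => norm_nonneg _) (hf.norm.const_mul _) ?_
  filter_upwards [ae_jacobiMeasure_mem_Icc α β] with y hy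
  rw [norm_smul]
  exact mul_le_mul_of_nonneg_right (h n x hx y hy) (norm_nonneg _)

/-- The Abel means are given by integration against the Jacobi-Poisson kernel. -/
theorem hasSum_jacobiAbelTerm (hα : -1 < α) (hβ : -1 < β) {r : ℝ}
    (hr0 : 0 < r) (hr1 : r < 1) {f : ℝ → 𝕜} (hf : Integrable f (jacobiMeasure α β))
    {x : ℝ} (hx : x ∈ Set.Icc (-1 : ℝ) 1) :
    HasSum (jacobiAbelTerm α β f r x)
      (∫ y, jacobiKernel α β r x y • f y ∂(jacobiMeasure α β)) := by
  obtain ⟨v, hv, h⟩ := exists_summable_bound_jacobiAbelTerm hα hβ hr0 hr1 hf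
  obtain ⟨u, hu, hu'⟩ := exists_summable_bound_jacobiKernelTerm hα hβ hr0 hr1
  have key := hasSum_integral_of_summable_integral_norm
    (F := fun n y => jacobiKernelTerm α β r x y n • f y) (μ := jacobiMeasure α β)
    (fun n => integrable_smul_jacobiMeasure (by unfold jacobiKernelTerm; fun_prop) hf)
    (.of_nonneg_of_le (fun n => integral_nonneg fun y => norm_nonneg _) (fun n => h n x hx) hv)
  rw [← funext fun n => jacobiAbelTerm_eq_integral f r x n] at key
  have he : ∫ y, jacobiKernel α β r x y • f y ∂(jacobiMeasure α β) =
      ∫ y, ∑' n, jacobiKernelTerm α β r x y n • f y ∂(jacobiMeasure α β) := by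
    refine integral_congr_ae ?_
    filter_upwards [ae_jacobiMeasure_mem_Icc α β] with y hy
    have hs : Summable (jacobiKernelTerm α β r x y) :=
      Summable.of_norm_bounded hu fun n => hu' n x hx y hy
    exact (hs.tsum_smul_const (f y)).symm
  rwa [he]

theorem jacobiAbel_eq_integral (hα : -1 < α) (hβ : -1 < β) {r : ℝ}
    (hr0 : 0 < r) (hr1 : r < 1) {f : ℝ → 𝕜} (hf : Integrable f (jacobiMeasure α β))
    {x : ℝ} (hx : x ∈ Set.Icc (-1 : ℝ) 1) :
    jacobiAbel α β f r x = ∫ y, jacobiKernel α β r x y • f y ∂(jacobiMeasure α β) :=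
  (hasSum_jacobiAbelTerm hα hβ hr0 hr1 hf hx).tsum_eq

theorem continuousOn_jacobiAbel (hα : -1 < α) (hβ : -1 < β) {r : ℝ}
    (hr0 : 0 < r) (hr1 : r < 1) {f : ℝ → 𝕜} (hf : Integrable f (jacobiMeasure α β)) :
    ContinuousOn (jacobiAbel α β f r) (Set.Icc (-1) 1) := by
  obtain ⟨v, hv, h⟩ := exists_summable_bound_jacobiAbelTerm hα hβ hr0 hr1 hf
  refine continuousOn_tsum (f := fun n x => jacobiAbelTerm α β f r x n) (fun n => ?_) hv
    fun n x hx => ?_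
  · unfold jacobiAbelTerm
    fun_prop
  · rw [jacobiAbelTerm_eq_integral]
    exact (norm_integral_le_integral_norm _).trans (h n x hx)

theorem jacobiCoeff_sum (hα : -1 < α) (hβ : -1 < β) (N : ℕ) (c : ℕ → 𝕜) (n : ℕ) :
    jacobiCoeff α β (fun x => ∑ m ∈ Finset.range N, (jacobiPoly α β m).eval x • c m) n =
      if n ∈ Finset.range N then c n else 0 := by
  obtain ⟨_, _, _, hpos⟩ := exists_jacobiPoly_growth hα hβ
  have h (m : ℕ) : ∫ y, (jacobiPoly α β n).eval y • (jacobiPoly α β m).eval y • c m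
      ∂(jacobiMeasure α β) = if n = m then jacobiNormSq α β n • c n else 0 := by
    simp only [smul_smul, integral_smul_const]
    split_ifs with hnm
    · subst hnm
      simp only [jacobiNormSq, sq]
    · rw [integral_jacobiPoly_mul_of_ne hα hβ hnm, zero_smul]
  simp only [jacobiCoeff, Finset.smul_sum]
  rw [integral_finsetSum _ fun m _ => integrable_jacobiMeasure_of_continuousOn hα hβ (by fun_prop),
    Finset.sum_congr rfl fun m _ => h m, Finset.sum_ite_eq]
  split_ifs
  · rw [smul_smul, one_div, inv_mul_cancel₀ (hpos n).1.ne', one_smul]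
  · rw [smul_zero]

theorem jacobiAbel_sum (hα : -1 < α) (hβ : -1 < β) (N : ℕ) (c : ℕ → 𝕜) (r x : ℝ) :
    jacobiAbel α β (fun x => ∑ m ∈ Finset.range N, (jacobiPoly α β m).eval x • c m) r x =
      ∑ n ∈ Finset.range N, (r ^ n * (jacobiPoly α β n).eval x) • c n := by
  rw [jacobiAbel, tsum_eq_sum (s := Finset.range N)]
  · refine Finset.sum_congr rfl fun n hn => ?_
    rw [jacobiAbelTerm, jacobiCoeff_sum hα hβ, if_pos hn]
  · intro n hn
    rw [jacobiAbelTerm, jacobiCoeff_sum hα hβ, if_neg hn, smul_zero]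

/-! ### Mass, positivity and contraction -/

/-- The Abel mean of the constant P_0 = 1 is 1. -/
theorem integral_jacobiKernel (hα : -1 < α) (hβ : -1 < β) {r : ℝ}
    (hr0 : 0 < r) (hr1 : r < 1) {x : ℝ} (hx : x ∈ Set.Icc (-1 : ℝ) 1) :
    ∫ y, jacobiKernel α β r x y ∂(jacobiMeasure α β) = 1 := by
  have h1 := jacobiAbel_eq_integral (𝕜 := ℝ) hα hβ hr0 hr1
    (f := fun x => ∑ m ∈ Finset.range 1, (jacobiPoly α β m).eval x • (1 : ℝ))
    (integrable_jacobiMeasure_of_continuousOn hα hβ (by fun_prop)) hx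
  rw [jacobiAbel_sum hα hβ] at h1
  simpa [jacobiPoly_zero] using h1.symm

/-- The integral is the Abel mean of q, a finite Poisson extension, so the maximum principle
applies. -/
theorem integral_jacobiKernel_mul_eval_nonneg (hα : -1 < α) (hβ : -1 < β) {r : ℝ}
    (hr0 : 0 < r) (hr1 : r < 1) {x : ℝ} (hx : x ∈ Set.Icc (-1 : ℝ) 1) {q : ℝ[X]}
    (hq : ∀ y ∈ Set.Icc (-1 : ℝ) 1, 0 ≤ q.eval y) :
    0 ≤ ∫ y, jacobiKernel α β r x y * q.eval y ∂(jacobiMeasure α β) := by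
  obtain ⟨N, a, ha⟩ := exists_sum_jacobiPoly hα hβ q
  have hqa (y : ℝ) : q.eval y = ∑ m ∈ Finset.range N, (jacobiPoly α β m).eval y • a m := by
    rw [ha N le_rfl]
    simp [eval_finsetSum, mul_comm]
  have h1 := jacobiAbel_eq_integral (𝕜 := ℝ) hα hβ hr0 hr1 (f := fun y => q.eval y)
    (integrable_jacobiMeasure_of_continuousOn hα hβ (by fun_prop)) hx
  simp only [smul_eq_mul] at h1
  rw [← h1]
  simp only [hqa]
  rw [jacobiAbel_sum hα hβ]
  refine (poissonExtension_nonneg hα hβ N a (fun y hy => ?_) ⟨hr0.le, hr1.le⟩ hx).trans_eq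
    (Finset.sum_congr rfl fun n _ => ?_)
  · refine (hq y hy).trans_eq ((hqa y).trans (Finset.sum_congr rfl fun n _ => ?_))
    rw [smul_eq_mul, mul_comm]
  · rw [smul_eq_mul]; ring

/-- The Jacobi-Poisson kernel is nonnegative. -/
theorem ae_jacobiKernel_nonneg (hα : -1 < α) (hβ : -1 < β) {r : ℝ}
    (hr0 : 0 < r) (hr1 : r < 1) {x : ℝ} (hx : x ∈ Set.Icc (-1 : ℝ) 1) :
    ∀ᵐ y ∂(jacobiMeasure α β), 0 ≤ jacobiKernel α β r x y := by
  have hK := continuousOn_jacobiKernel_right hα hβ hr0 hr1 hx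
  obtain ⟨K, hKdef⟩ : ∃ K, K = jacobiKernel α β r x := ⟨_, rfl⟩
  rw [← hKdef] at hK ⊢
  have hg : ContinuousOn (fun y => max (-K y) 0) (Set.Icc (-1) 1) := hK.neg.sup continuousOn_const
  have hint {f : ℝ → ℝ} (hf : ContinuousOn f (Set.Icc (-1) 1)) :=
    integrable_jacobiMeasure_of_continuousOn hα hβ hf
  have hle : ∫ y, max (-K y) 0 ^ 2 ∂(jacobiMeasure α β) ≤ 0 := by
    suffices h : ∀ ε > 0, ∫ y, max (-K y) 0 ^ 2 ∂(jacobiMeasure α β) ≤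
        ε * (2 * ∫ y, |K y| ∂(jacobiMeasure α β)) by
      refine ge_of_tendsto (x := 𝓝[>] (0 : ℝ))
        (f := fun ε => ε * (2 * ∫ y, |K y| ∂(jacobiMeasure α β))) ?_
        (eventually_mem_nhdsWithin.mono fun ε hε => h ε hε)
      exact ((continuous_mul_const _).tendsto' 0 0 (zero_mul _)).mono_left nhdsWithin_le_nhds
    intro ε hε
    -- With K⁻ the negative part, K⁻ < q < K⁻ + 2ε. Thus K q + (K⁻)² ≤ 2ε|K| pointwise, while ∫ K q
    -- ≥ 0.
    obtain ⟨q, hq⟩ := exists_polynomial_near_of_continuousOn (-1) 1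
      (fun y => max (-K y) 0 + ε) (hg.add continuousOn_const) ε hε
    have h1 := integral_jacobiKernel_mul_eval_nonneg hα hβ hr0 hr1 hx (q := q) fun y hy => by
      have := (abs_lt.1 (hq y hy)).1
      linarith [le_max_right (-K y) 0]
    rw [← hKdef] at h1
    have h2 : ∫ y, (K y * q.eval y + max (-K y) 0 ^ 2) ∂(jacobiMeasure α β) ≤
        ∫ y, 2 * ε * |K y| ∂(jacobiMeasure α β) := by
      refine integral_mono_ae (hint (by fun_prop)) (hint (by fun_prop)) ?_
      filter_upwards [ae_jacobiMeasure_mem_Icc α β] with y hy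
      obtain ⟨h3, h4⟩ := abs_lt.1 (hq y hy)
      rcases le_total (K y) 0 with h | h
      · rw [max_eq_left (by linarith)] at h3 h4 ⊢
        rw [abs_of_nonpos h]
        nlinarith
      · rw [max_eq_right (by linarith)] at h3 h4 ⊢
        rw [abs_of_nonneg h]
        nlinarith
    rw [integral_add (hint (by fun_prop)) (hint (by fun_prop)), integral_const_mul] at h2
    linarith
  have h0 := (integral_eq_zero_iff_of_nonneg (fun y => sq_nonneg (max (-K y) 0))
    (hint (hg.pow 2))).1 (hle.antisymm (integral_nonneg fun y => sq_nonneg _))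
  filter_upwards [h0] with y hy
  have h1 : max (-K y) 0 = 0 := by simpa using hy
  linarith [le_max_left (-K y) 0]

theorem lintegral_enorm_jacobiKernel (hα : -1 < α) (hβ : -1 < β) {r : ℝ}
    (hr0 : 0 < r) (hr1 : r < 1) {x : ℝ} (hx : x ∈ Set.Icc (-1 : ℝ) 1) :
    ∫⁻ y, ‖jacobiKernel α β r x y‖ₑ ∂(jacobiMeasure α β) = 1 := by
  have hi := integrable_jacobiMeasure_of_continuousOn hα hβ
    (continuousOn_jacobiKernel_right hα hβ hr0 hr1 hx)
  rw [← ofReal_integral_norm_eq_lintegral_enorm hi, ← ENNReal.ofReal_one,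
    ← integral_jacobiKernel hα hβ hr0 hr1 hx]
  congr 1
  refine integral_congr_ae ?_
  filter_upwards [ae_jacobiKernel_nonneg hα hβ hr0 hr1 hx] with y hy
  exact Real.norm_of_nonneg hy

/-- Jensen's inequality for integration against a density of total mass one. -/
theorem lintegral_mul_enorm_rpow_le {X E : Type*} [MeasurableSpace X] [NormedAddCommGroup E]
    {μ : Measure X} {k : X → ℝ≥0∞} (hk : AEMeasurable k μ) (hk1 : ∫⁻ y, k y ∂μ = 1) {f : X → E}
    (hf : AEStronglyMeasurable f μ) {t : ℝ} (ht : 1 ≤ t) :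
    (∫⁻ y, k y * ‖f y‖ₑ ∂μ) ^ t ≤ ∫⁻ y, k y * ‖f y‖ₑ ^ t ∂μ := by
  have hprob : IsProbabilityMeasure (μ.withDensity k) :=
    ⟨by rw [withDensity_apply _ MeasurableSet.univ, Measure.restrict_univ, hk1]⟩
  have h := eLpNorm'_le_eLpNorm'_of_exponent_le zero_lt_one ht (μ.withDensity k)
    (hf.mono_ac (withDensity_absolutelyContinuous μ k))
  simp only [eLpNorm', ENNReal.rpow_one, div_one] at h
  rw [lintegral_withDensity_eq_lintegral_mul₀ hk hf.enorm,
    lintegral_withDensity_eq_lintegral_mul₀ hk (hf.enorm.pow_const t)] at h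
  have h2 := ENNReal.rpow_le_rpow h (by linarith : 0 ≤ t)
  rw [← ENNReal.rpow_mul, one_div, inv_mul_cancel₀ (by linarith), ENNReal.rpow_one] at h2
  exact h2

/-- The Abel means are contractions of `L^p`. -/
theorem eLpNorm_jacobiAbel_le (hα : -1 < α) (hβ : -1 < β) {r : ℝ}
    (hr0 : 0 < r) (hr1 : r < 1) {p : ℝ≥0∞} (hp : 1 ≤ p) (hp_top : p ≠ ∞) {f : ℝ → 𝕜}
    (hf : Integrable f (jacobiMeasure α β)) :
    eLpNorm (jacobiAbel α β f r) p (jacobiMeasure α β) ≤ eLpNorm f p (jacobiMeasure α β) := by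
  have := isFiniteMeasure_jacobiMeasure hα hβ
  have hp0 : p ≠ 0 := (zero_lt_one.trans_le hp).ne'
  have ht : 1 ≤ p.toReal := by simpa using ENNReal.toReal_mono hp_top hp
  rw [eLpNorm_eq_lintegral_rpow_enorm_toReal hp0 hp_top,
    eLpNorm_eq_lintegral_rpow_enorm_toReal hp0 hp_top]
  refine ENNReal.rpow_le_rpow ?_ (by positivity)
  have hKm {x : ℝ} (hx : x ∈ Set.Icc (-1 : ℝ) 1) :
      AEMeasurable (fun y => ‖jacobiKernel α β r x y‖ₑ) (jacobiMeasure α β) :=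
    (integrable_jacobiMeasure_of_continuousOn hα hβ
      (continuousOn_jacobiKernel_right hα hβ hr0 hr1 hx)).1.enorm
  have hK2 : AEMeasurable (fun z : ℝ × ℝ => ‖jacobiKernel α β r z.1 z.2‖ₑ)
      ((jacobiMeasure α β).prod (jacobiMeasure α β)) := by
    rw [← jacobiMeasure_restrict, Measure.prod_restrict]
    exact ((continuousOn_jacobiKernel hα hβ hr0 hr1).aemeasurable
      (measurableSet_Icc.prod measurableSet_Icc)).enorm
  calc ∫⁻ x, ‖jacobiAbel α β f r x‖ₑ ^ p.toReal ∂(jacobiMeasure α β)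
      ≤ ∫⁻ x, ∫⁻ y, ‖jacobiKernel α β r x y‖ₑ * ‖f y‖ₑ ^ p.toReal ∂(jacobiMeasure α β)
          ∂(jacobiMeasure α β) := by
        refine lintegral_mono_ae ?_
        filter_upwards [ae_jacobiMeasure_mem_Icc α β] with x hx
        refine le_trans (ENNReal.rpow_le_rpow ?_ (by linarith)) (lintegral_mul_enorm_rpow_le
          (hKm hx) (lintegral_enorm_jacobiKernel hα hβ hr0 hr1 hx) hf.1 ht)
        rw [jacobiAbel_eq_integral hα hβ hr0 hr1 hf hx]
        refine (enorm_integral_le_lintegral_enorm _).trans_eq ?_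
        simp only [enorm_smul]
    _ = ∫⁻ y, ∫⁻ x, ‖jacobiKernel α β r x y‖ₑ * ‖f y‖ₑ ^ p.toReal ∂(jacobiMeasure α β)
          ∂(jacobiMeasure α β) :=
        lintegral_lintegral_swap (hK2.mul (hf.1.comp_snd.enorm.pow_const _))
    _ = ∫⁻ y, ‖f y‖ₑ ^ p.toReal ∂(jacobiMeasure α β) := by
        refine lintegral_congr_ae ?_
        filter_upwards [ae_jacobiMeasure_mem_Icc α β] with y hy
        -- By symmetry the kernel has mass one in x as well.
        simp only [jacobiKernel_comm α β r _ y]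
        rw [lintegral_mul_const'' _ (hKm hy), lintegral_enorm_jacobiKernel hα hβ hr0 hr1 hy,
          one_mul]

theorem memLp_jacobiAbel (hα : -1 < α) (hβ : -1 < β) {r : ℝ}
    (hr0 : 0 < r) (hr1 : r < 1) {p : ℝ≥0∞} (hp : 1 ≤ p) (hp_top : p ≠ ∞) {f : ℝ → 𝕜}
    (hf : MemLp f p (jacobiMeasure α β)) :
    MemLp (jacobiAbel α β f r) p (jacobiMeasure α β) := by
  have := isFiniteMeasure_jacobiMeasure hα hβ
  have hfi := hf.integrable hp
  exact ⟨(integrable_jacobiMeasure_of_continuousOn hα hβ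
    (continuousOn_jacobiAbel hα hβ hr0 hr1 hfi)).1,
    (eLpNorm_jacobiAbel_le hα hβ hr0 hr1 hp hp_top hfi).trans_lt hf.2⟩

end AbelMeans

/-! ### Density and convergence -/

/-- Finite combinations of Jacobi polynomials are dense in `L^p`. -/
theorem exists_sum_jacobiPoly_eLpNorm_sub_le {𝕜 : Type*} [RCLike 𝕜] {α β : ℝ} (hα : -1 < α)
    (hβ : -1 < β) {p : ℝ≥0∞} (hp : 1 ≤ p) (hp_top : p ≠ ∞) {f : ℝ → 𝕜}
    (hf : MemLp f p (jacobiMeasure α β)) {ε : ℝ≥0∞} (hε : ε ≠ 0) :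
    ∃ (N : ℕ) (c : ℕ → 𝕜),
      eLpNorm (fun x => f x - ∑ n ∈ Finset.range N, (jacobiPoly α β n).eval x • c n) p
        (jacobiMeasure α β) ≤ ε := by
  have := isFiniteMeasure_jacobiMeasure hα hβ
  obtain ⟨g, hg, hgL⟩ := hf.exists_boundedContinuous_eLpNorm_sub_le hp_top
    (ENNReal.half_pos hε).ne'
  have hlim : Tendsto (fun δ : ℝ => jacobiMeasure α β Set.univ ^ p.toReal⁻¹ *
      ENNReal.ofReal (2 * δ)) (𝓝[>] 0) (𝓝 0) := by
    have h1 : Tendsto (fun δ : ℝ => ENNReal.ofReal (2 * δ)) (𝓝[>] 0) (𝓝 0) := by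
      have : Continuous fun δ : ℝ => ENNReal.ofReal (2 * δ) :=
        ENNReal.continuous_ofReal.comp (continuous_const_mul 2)
      exact (this.tendsto' 0 0 (by simp)).mono_left nhdsWithin_le_nhds
    have h2 := ENNReal.Tendsto.const_mul (a := jacobiMeasure α β Set.univ ^ p.toReal⁻¹) h1
      (Or.inr (ENNReal.rpow_ne_top_of_nonneg (by positivity) (measure_ne_top _ _)))
    rwa [mul_zero] at h2
  obtain ⟨δ, hδ, hδ0⟩ := ((hlim.eventually (gt_mem_nhds (ENNReal.half_pos hε))).and
    eventually_mem_nhdsWithin).exists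
  obtain ⟨q₁, hq₁⟩ := exists_polynomial_near_of_continuousOn (-1) 1 (fun x => RCLike.re (g x))
    (RCLike.continuous_re.comp g.continuous).continuousOn δ hδ0
  obtain ⟨q₂, hq₂⟩ := exists_polynomial_near_of_continuousOn (-1) 1 (fun x => RCLike.im (g x))
    (RCLike.continuous_im.comp g.continuous).continuousOn δ hδ0
  obtain ⟨N₁, a, ha⟩ := exists_sum_jacobiPoly hα hβ q₁
  obtain ⟨N₂, b, hb⟩ := exists_sum_jacobiPoly hα hβ q₂
  -- Real and imaginary parts are approximated separately; both expansions remain valid over the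
  -- common longer range.
  refine ⟨max N₁ N₂, fun n => (a n : 𝕜) + b n * RCLike.I, ?_⟩
  have hsum (x : ℝ) : ∑ n ∈ Finset.range (max N₁ N₂),
      (jacobiPoly α β n).eval x • ((a n : 𝕜) + b n * RCLike.I) =
      ((q₁.eval x : ℝ) : 𝕜) + ((q₂.eval x : ℝ) : 𝕜) * RCLike.I := by
    rw [ha _ (le_max_left _ _), hb _ (le_max_right _ _)]
    simp only [eval_finsetSum, eval_smul, smul_eq_mul, RCLike.ofReal_sum, RCLike.ofReal_mul,
      Finset.sum_mul, RCLike.real_smul_eq_coe_mul, mul_add, Finset.sum_add_distrib]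
    congr 1 <;> refine Finset.sum_congr rfl fun n _ => by ring
  simp only [hsum]
  have hclose : eLpNorm (fun x => g x - (((q₁.eval x : ℝ) : 𝕜) +
      ((q₂.eval x : ℝ) : 𝕜) * RCLike.I)) p (jacobiMeasure α β) ≤ ε / 2 := by
    refine (eLpNorm_le_of_ae_bound (C := 2 * δ) ?_).trans hδ.le
    filter_upwards [ae_jacobiMeasure_mem_Icc α β] with x hx
    have e : g x - (((q₁.eval x : ℝ) : 𝕜) + ((q₂.eval x : ℝ) : 𝕜) * RCLike.I) =
        -(((q₁.eval x - RCLike.re (g x) : ℝ) : 𝕜)) +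
        -((q₂.eval x - RCLike.im (g x) : ℝ) : 𝕜) * RCLike.I := by
      conv_lhs => rw [← RCLike.re_add_im (g x)]
      push_cast
      ring
    rw [e]
    refine (norm_add_le _ _).trans ?_
    have hI : ‖(RCLike.I : 𝕜)‖ ≤ 1 := by
      rcases RCLike.I_mul_I (K := 𝕜) with h | h
      · simp [h]
      · rw [RCLike.norm_I_of_ne_zero]
        rintro h0
        simp [h0] at h
    rw [norm_mul, norm_neg, norm_neg, RCLike.norm_ofReal, RCLike.norm_ofReal]
    have h1 := hq₁ x hx
    have h2 := hq₂ x hx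
    have h3 := mul_le_of_le_one_right (abs_nonneg (q₂.eval x - RCLike.im (g x))) hI
    linarith
  have hq : Continuous fun x =>
      ((q₁.eval x : ℝ) : 𝕜) + ((q₂.eval x : ℝ) : 𝕜) * RCLike.I :=
    (RCLike.continuous_ofReal.comp q₁.continuous).add
      ((RCLike.continuous_ofReal.comp q₂.continuous).mul continuous_const)
  have he : (fun x => f x - (((q₁.eval x : ℝ) : 𝕜) + ((q₂.eval x : ℝ) : 𝕜) * RCLike.I)) =
      (f - ⇑g) + fun x => g x - (((q₁.eval x : ℝ) : 𝕜) + ((q₂.eval x : ℝ) : 𝕜) * RCLike.I) := by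
    ext x
    exact (sub_add_sub_cancel _ _ _).symm
  rw [he]
  exact (eLpNorm_add_le (hf.1.sub hgL.1) (hgL.1.sub hq.aestronglyMeasurable) hp).trans
    ((add_le_add hg hclose).trans_eq (ENNReal.add_halves ε))

theorem tendsto_eLpNorm_jacobiAbel_sum_sub {𝕜 : Type*} [RCLike 𝕜] {α β : ℝ} (hα : -1 < α)
    (hβ : -1 < β) {p : ℝ≥0∞} (hp : 1 ≤ p) (N : ℕ) (c : ℕ → 𝕜) :
    Tendsto (fun r : ℝ => eLpNorm (fun x =>
      jacobiAbel α β (fun x => ∑ n ∈ Finset.range N, (jacobiPoly α β n).eval x • c n) r x -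
        ∑ n ∈ Finset.range N, (jacobiPoly α β n).eval x • c n) p (jacobiMeasure α β))
      (𝓝[<] 1) (𝓝 0) := by
  have := isFiniteMeasure_jacobiMeasure hα hβ
  have hmem (n : ℕ) : MemLp (fun x => (jacobiPoly α β n).eval x • c n) p (jacobiMeasure α β) := by
    have hcont : Continuous fun x => (jacobiPoly α β n).eval x • c n := by fun_prop
    obtain ⟨C, hC⟩ := isCompact_Icc.exists_bound_of_continuousOn
      (s := Set.Icc (-1 : ℝ) 1) hcont.continuousOn
    exact MemLp.of_bound hcont.aestronglyMeasurable C
      ((ae_jacobiMeasure_mem_Icc α β).mono hC)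
  have hlim : Tendsto (fun r : ℝ => ∑ n ∈ Finset.range N, ‖r ^ n - 1‖ₑ *
      eLpNorm (fun x => (jacobiPoly α β n).eval x • c n) p (jacobiMeasure α β))
      (𝓝[<] 1) (𝓝 0) := by
    rw [← Finset.sum_const_zero (s := Finset.range N)]
    refine tendsto_finsetSum _ fun n _ => ?_
    have h1 : Tendsto (fun r : ℝ => ‖r ^ n - 1‖ₑ) (𝓝[<] 1) (𝓝 0) := by
      have : Continuous fun r : ℝ => ‖r ^ n - 1‖ₑ := by fun_prop
      exact (this.tendsto' 1 0 (by simp)).mono_left nhdsWithin_le_nhds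
    have h2 := ENNReal.Tendsto.mul_const h1 (Or.inr (hmem n).2.ne)
    rwa [zero_mul] at h2
  refine tendsto_of_tendsto_of_tendsto_of_le_of_le tendsto_const_nhds hlim
    (fun _ => zero_le) fun r => ?_
  have he : (fun x => jacobiAbel α β
        (fun x => ∑ n ∈ Finset.range N, (jacobiPoly α β n).eval x • c n) r x -
        ∑ n ∈ Finset.range N, (jacobiPoly α β n).eval x • c n) =
      ∑ n ∈ Finset.range N, (r ^ n - 1) • fun x => (jacobiPoly α β n).eval x • c n := by
    ext x
    rw [jacobiAbel_sum hα hβ, ← Finset.sum_sub_distrib, Finset.sum_apply]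
    refine Finset.sum_congr rfl fun n _ => ?_
    rw [Pi.smul_apply, smul_smul, ← sub_smul, sub_mul, one_mul]
  simp only [he]
  refine (eLpNorm_sum_le (fun n _ => (hmem n).1.const_smul _) hp).trans_eq ?_
  exact Finset.sum_congr rfl fun n _ => eLpNorm_const_smul _ _ _ _

theorem mainTheorem11 {𝕜 : Type*} [RCLike 𝕜] (α β : ℝ) (hα : -1 < α) (hβ : -1 < β)
    (p : ℝ≥0∞) (hp : 1 ≤ p) (hp_top : p ≠ ∞)
    (f : ℝ → 𝕜) (hf : MemLp f p (jacobiMeasure α β)) :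
    (∀ r : ℝ, 0 < r → r < 1 →
      (∀ x ∈ Set.Icc (-1 : ℝ) 1, Summable (jacobiAbelTerm α β f r x)) ∧
      MemLp (jacobiAbel α β f r) p (jacobiMeasure α β)) ∧
    Tendsto (fun r : ℝ => eLpNorm (fun x => jacobiAbel α β f r x - f x) p (jacobiMeasure α β))
      (𝓝[<] 1) (𝓝 0) := by
  have := isFiniteMeasure_jacobiMeasure hα hβ
  refine ⟨fun r hr0 hr1 => ⟨fun x hx =>
    (hasSum_jacobiAbelTerm hα hβ hr0 hr1 (hf.integrable hp) hx).summable,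
    memLp_jacobiAbel hα hβ hr0 hr1 hp hp_top hf⟩, ?_⟩
  rw [ENNReal.tendsto_nhds_zero]
  intro ε hε
  have hε3 : ε / 3 ≠ 0 := (ENNReal.div_pos hε.ne' (by norm_num)).ne'
  obtain ⟨N, c, hN⟩ := exists_sum_jacobiPoly_eLpNorm_sub_le hα hβ hp hp_top hf hε3
  have hlim := tendsto_eLpNorm_jacobiAbel_sum_sub hα hβ hp N c
  have hgc : Continuous fun x => ∑ n ∈ Finset.range N, (jacobiPoly α β n).eval x • c n := by
    fun_prop
  obtain ⟨g, hg⟩ : ∃ g : ℝ → 𝕜,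
    g = fun x => ∑ n ∈ Finset.range N, (jacobiPoly α β n).eval x • c n := ⟨_, rfl⟩
  have hgx (x : ℝ) : ∑ n ∈ Finset.range N, (jacobiPoly α β n).eval x • c n = g x := by rw [hg]
  rw [← hg] at hgc
  simp only [hgx] at hlim hN
  have hgi : Integrable g (jacobiMeasure α β) :=
    integrable_jacobiMeasure_of_continuousOn hα hβ hgc.continuousOn
  have hfi := hf.integrable hp
  filter_upwards [(ENNReal.tendsto_nhds_zero.1 hlim) (ε / 3) hε3.bot_lt,
    Ioo_mem_nhdsLT (zero_lt_one (α := ℝ))] with r hr hr01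
  have hAg := (integrable_jacobiMeasure_of_continuousOn hα hβ
    (continuousOn_jacobiAbel hα hβ hr01.1 hr01.2 hgi)).1
  have hAfg := (integrable_jacobiMeasure_of_continuousOn hα hβ
    (continuousOn_jacobiAbel hα hβ hr01.1 hr01.2 (hfi.sub hgi))).1
  have h1 : eLpNorm (jacobiAbel α β (f - g) r) p (jacobiMeasure α β) ≤ ε / 3 :=
    (eLpNorm_jacobiAbel_le hα hβ hr01.1 hr01.2 hp hp_top (hfi.sub hgi)).trans hN
  have h3 : eLpNorm (g - f) p (jacobiMeasure α β) ≤ ε / 3 := by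
    rw [eLpNorm_sub_comm]; exact hN
  -- Linearity of the means is read off the kernel integral, available on [-1, 1], hence only almost
  -- everywhere on ℝ.
  have he : (fun x => jacobiAbel α β f r x - f x) =ᵐ[jacobiMeasure α β]
      jacobiAbel α β (f - g) r + ((jacobiAbel α β g r - g) + (g - f)) := by
    filter_upwards [ae_jacobiMeasure_mem_Icc α β] with x hx
    simp only [Pi.add_apply, Pi.sub_apply]
    rw [jacobiAbel_eq_integral hα hβ hr01.1 hr01.2 (hfi.sub hgi) hx,
      jacobiAbel_eq_integral hα hβ hr01.1 hr01.2 hfi hx,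
      jacobiAbel_eq_integral hα hβ hr01.1 hr01.2 hgi hx]
    simp only [Pi.sub_apply, smul_sub]
    have hK := continuousOn_jacobiKernel_right hα hβ hr01.1 hr01.2 hx
    rw [integral_sub (integrable_smul_jacobiMeasure hK hfi) (integrable_smul_jacobiMeasure hK hgi)]
    ring
  rw [eLpNorm_congr_ae he]
  refine (eLpNorm_add_le hAfg ((hAg.sub hgi.1).add (hgi.1.sub hf.1)) hp).trans ?_
  refine (add_le_add h1 ((eLpNorm_add_le (hAg.sub hgi.1) (hgi.1.sub hf.1) hp).trans
    (add_le_add hr h3))).trans_eq ?_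
  rw [← add_assoc, ENNReal.add_thirds]
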